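/- Let $G$ be a compact Lie group (possibly disconnected), with Lie algebra $\mathfrak g=T_1G$, acting smoothly, transitively, virtually effectively (the kernel of the action is finite) and by isometries on a compact connected Riemannian manifold $M$ with Riemannian distance $\rho$. Let $o\in M$, and assume that $M$ is isotropy irreducible: the stabilizer $H$ of $o$ has no invariant subspaces in $T_oM$ other than $0$ and $T_oM$. Let $G$ carry a bi-invariant Riemannian metric for which $G\to M$, $g\mapsto g\cdot o$, is a Riemannian submersion; norms and orthogonality in $\mathfrak g$ refer to it. For $p\in M$ let $\mathfrak h_p\subseteq\mathfrak g$ be the Lie algebra of the stabilizer of $p$. For $\xi\in\mathfrak g$ and a smooth function $f$ on $M$ let $\xi f$ be the derivative of $f$ along the vector field induced by $\xi$, i.e. $(\xi f)(q)=\frac{d}{dt}\big|_{t=0}f(\exp(t\xi)\cdot q)$. Let $L^2(M)$ be the real $L^2$-space of the $G$-invariant probability measure on $M$, let $\mathcal E\neq 0$ be a finite dimensional $G$-invariant linear subspace of $L^2(M)$ orthogonal to the constants, and let $\mathcal S$ be the unit sphere of $\mathcal E$. Every $u\in\mathcal E$ is represented by a (unique) smooth function, also denoted by $u$. For every $p\in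 M$ there is a (unique) $\phi_p\in\mathcal E$ with $\langle u,\phi_p\rangle=u(p)$ for all $u\in\mathcal E$, and $|\phi_p|=\sqrt{\dim\mathcal E}=:c$ for every $p$. For the map $\iota:M\to\mathcal S$, $\iota(p)=\phi_p/|\phi_p|$, there is a number $s>0$ such that $|d_p\iota(v)|=s|v|$ for all $p\in M$, $v\in T_pM$. Put $\kappa=cs$. Then for every $u\in\mathcal S$: 1. $|u(p)-u(q)|\le\kappa\,\rho(p,q)$ for all $p,q\in M$; 2. $\kappa$ is the smallest Lipschitz constant of $u$ if and only if $u=\frac1\kappa\,\xi\phi_p$ for some $p\in M$ and some $\xi\in\mathfrak g$ with $\xi\perp\mathfrak h_p$ and $|\xi|=1$. -/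

import Mathlib

open MeasureTheory Bundle
open scoped Manifold ContDiff

noncomputable section

/-! Conventions: `G` is a Lie group modelled on `ℝⁿ`, `M` is a manifold modelled on `ℝᵐ`.
A Riemannian metric on a manifold is a `RiemannianBundle` structure on its tangent bundle; it gives
the norm and the inner product of every tangent space. -/

/-- The differential of the translation `x ↦ g • x` preserves the Riemannian norm, for all `g`:
the group `G` acts on the Riemannian manifold `M` by isometries. -/
def ActsByIsometries (m : ℕ) (G : Type*) [Group G] (M : Type*) [TopologicalSpace M]
    [ChartedSpace (EuclideanSpace ℝ (Fin m)) M] [MulAction G M]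
    [RiemannianBundle (fun x : M => TangentSpace (𝓡 m) x)] : Prop :=
  ∀ (g : G) (x : M) (v : TangentSpace (𝓡 m) x),
    ‖mfderiv (𝓡 m) (𝓡 m) (fun y : M => g • y) x v‖ = ‖v‖

/-- The stabilizer of `o` has no invariant subspaces in `T_o M` except `0` and `T_o M`. (If
`g • o = o`, then the differential of `x ↦ g • x` at `o` is an endomorphism of `T_o M`.) -/
def IsotropyIrreducible (m : ℕ) (G : Type*) [Group G] {M : Type*} [TopologicalSpace M]
    [ChartedSpace (EuclideanSpace ℝ (Fin m)) M] [MulAction G M] (o : M) : Prop :=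
  ∀ W : Submodule ℝ (TangentSpace (𝓡 m) o),
    (∀ g : G, g • o = o → ∀ v ∈ W,
      (mfderiv (𝓡 m) (𝓡 m) (fun y : M => g • y) o v : TangentSpace (𝓡 m) o) ∈ W) →
    W = ⊥ ∨ W = ⊤

/-- The Riemannian metric of the Lie group `G` is invariant under left and right translations. -/
def IsBiInvariant (n : ℕ) (G : Type*) [Group G] [TopologicalSpace G]
    [ChartedSpace (EuclideanSpace ℝ (Fin n)) G]
    [RiemannianBundle (fun g : G => TangentSpace (𝓡 n) g)] : Prop :=
  ∀ (a g : G) (v : TangentSpace (𝓡 n) g),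
    ‖mfderiv (𝓡 n) (𝓡 n) (fun h : G => a * h) g v‖ = ‖v‖ ∧
    ‖mfderiv (𝓡 n) (𝓡 n) (fun h : G => h * a) g v‖ = ‖v‖

/-- `η : N → M` is a metric (Riemannian) submersion: at each point the differential is onto and it
is isometric on the orthogonal complement of its kernel. -/
def IsMetricSubmersion {n m : ℕ} {N M : Type*} [TopologicalSpace N] [TopologicalSpace M]
    [ChartedSpace (EuclideanSpace ℝ (Fin n)) N] [ChartedSpace (EuclideanSpace ℝ (Fin m)) M]
    [RiemannianBundle (fun x : N => TangentSpace (𝓡 n) x)]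
    [RiemannianBundle (fun x : M => TangentSpace (𝓡 m) x)] (η : N → M) : Prop :=
  ContMDiff (𝓡 n) (𝓡 m) ∞ η ∧
  ∀ x : N, Function.Surjective (mfderiv (𝓡 n) (𝓡 m) η x) ∧
    ∀ v : TangentSpace (𝓡 n) x,
      (∀ w : TangentSpace (𝓡 n) x, mfderiv (𝓡 n) (𝓡 m) η x w = 0 → inner ℝ v w = 0) →
      ‖mfderiv (𝓡 n) (𝓡 m) η x v‖ = ‖v‖

/-- The Lie algebra of the stabilizer of `p` in `G`, as a subset of the Lie algebra `T₁G` of `G`: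
the velocity vectors at `1` of the curves in `G` that start at `1` and stay in the stabilizer. -/
def stabilizerAlgebra (n : ℕ) (G : Type*) [Group G] [TopologicalSpace G]
    [ChartedSpace (EuclideanSpace ℝ (Fin n)) G] {M : Type*} [MulAction G M] (p : M) :
    Set (TangentSpace (𝓡 n) (1 : G)) :=
  {ξ | ∃ γ : ℝ → G, γ 0 = 1 ∧ (∀ t, γ t ∈ MulAction.stabilizer G p) ∧
    MDifferentiableAt 𝓘(ℝ, ℝ) (𝓡 n) γ 0 ∧
    (mfderiv 𝓘(ℝ, ℝ) (𝓡 n) γ 0 (1 : ℝ) : TangentSpace (𝓡 n) (1 : G)) = ξ}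

/-- The derivative `ξ f` of a function `f` on `M` along the vector field on `M` induced by an element
`ξ` of the Lie algebra of `G` (the projection of the right invariant field on `G` equal to `ξ` at
`1`): `(ξ f)(q)` is the derivative of `g ↦ f (g • q)` at `g = 1` along `ξ`. -/
def actionDeriv {n : ℕ} {G : Type*} [Group G] [TopologicalSpace G]
    [ChartedSpace (EuclideanSpace ℝ (Fin n)) G] {M : Type*} [MulAction G M]
    (ξ : TangentSpace (𝓡 n) (1 : G)) (f : M → ℝ) (q : M) : ℝ :=
  mfderiv (𝓡 n) 𝓘(ℝ, ℝ) (fun g : G => f (g • q)) 1 ξ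

/-- A linear subspace `V` of `L²(M)` is `G`-invariant: it contains `u ∘ g` for all `u ∈ V`, `g ∈ G`.
(The function `u ∘ g` is in `L²(M)` if the measure is invariant.) -/
def IsInvariantSubspace (G : Type*) [Group G] {M : Type*} [MeasurableSpace M] [MulAction G M]
    {μ : Measure M} (V : Submodule ℝ (Lp ℝ 2 μ)) : Prop :=
  ∀ (g : G), ∀ u ∈ V, ∀ w : Lp ℝ 2 μ, (w =ᵐ[μ] fun x => u (g • x)) → w ∈ V

open Classical in
/-- The continuous function that represents the class `u ∈ L²(M)`, if there is one. -/
def contRep {M : Type*} [TopologicalSpace M] [MeasurableSpace M] {μ : Measure M}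
    (u : Lp ℝ 2 μ) : M → ℝ :=
  if h : ∃ f : M → ℝ, Continuous f ∧ f =ᵐ[μ] u then h.choose else 0

open Classical in
/-- The vector `φ_p ∈ V` that realizes the evaluation functional at `p`: `⟨u, φ_p⟩ = u(p)` for all
`u ∈ V`. -/
def evalVec {M : Type*} [TopologicalSpace M] [MeasurableSpace M] {μ : Measure M}
    (V : Submodule ℝ (Lp ℝ 2 μ)) (p : M) : V :=
  if h : ∃ φ : V, ∀ u : V, inner ℝ u φ = contRep (u : Lp ℝ 2 μ) p then h.choose else 0

/-- The map `ι : M → V`, `ι(p) = φ_p / |φ_p|`. -/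
def sphereMap {M : Type*} [TopologicalSpace M] [MeasurableSpace M] {μ : Measure M}
    (V : Submodule ℝ (Lp ℝ 2 μ)) (p : M) : V :=
  ‖evalVec V p‖⁻¹ • evalVec V p

/-- The differential `d_p ι (v)`, as a vector of the Euclidean space `V`. -/
def sphereMapDeriv {m : ℕ} {M : Type*} [TopologicalSpace M]
    [ChartedSpace (EuclideanSpace ℝ (Fin m)) M] [MeasurableSpace M] {μ : Measure M}
    (V : Submodule ℝ (Lp ℝ 2 μ)) (p : M) (v : TangentSpace (𝓡 m) p) : V :=
  mfderiv (𝓡 m) 𝓘(ℝ, V) (sphereMap V) p v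

end

/-! By the reproducing property, `u(p) = ⟨u, φ_p⟩`, so every `u` is a linear functional composed
with the single map `φ : M → V`. This map is equivariant for the orthogonal representation of `G` on
`V` (`evalVec_smul`). Hence `|dφ|²` at `o` is invariant under the isotropy representation. With `L =
d_oφ`, an eigenspace of `L* L` is an invariant subspace, so irreducibility gives `|dφ(v)| = κ|v|` at
`o`, and transitivity gives it everywhere (`exists_norm_mvfderiv_eq`). Since `|φ_p| = √(dim V)` is
constant, this is the constant `c s`. It is positive, because otherwise `V` would consist of
constants of mean zero.

Claim 1 is Cauchy-Schwarz, `|du(v)| = |⟨u, dφ(v)⟩| ≤ κ|v|`, integrated along paths. For claim 2, the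
maximum of `|du|` over unit tangent vectors is attained, since these are parametrized by the compact
space `G × S(T_oM)`, and this maximum is itself a Lipschitz constant. If `κ` is the least one,
equality holds in Cauchy-Schwarz and `u = κ⁻¹ dφ(v)` with `|v| = 1`
(`exists_eq_mvfderiv_of_isLeast_lipschitz`). Conversely, for such `u` the derivative along `v`
equals `κ` (`isLeast_lipschitz_of_eq_mvfderiv`).

Passing from `v` to `ξ`: every orbit map is a metric submersion (`orbit_submersion`) whose
differential at `1` has kernel `h_p` (`mem_stabilizerAlgebra_iff`), so unit vectors `v` lift to unit
vectors `ξ ⊥ h_p`. Differentiating the invariance of `⟨φ_p, φ_q⟩` gives `ξ φ_p = -dφ(ξ p)`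
(`actionDeriv_inner`), and the sign is absorbed into `ξ`.

All this needs smooth representatives of the elements of `V` (`exists_contMDiff_ae_eq`). The matrix
coefficients of `V` are smooth functions on `G`, by differentiation under the integral and density
of smooth functions. A Fubini argument expresses `u` along some orbit map through them, and local
sections carry smoothness down to `M`. -/

section

open Set Filter Topology
open scoped InnerProductSpace

/-! ### Smooth dependence of integrals on a parameter -/

section ParametricIntegral

variable {E : Type} [NormedAddCommGroup E] [NormedSpace ℝ E]
  {m : ℕ} {M : Type*} [TopologicalSpace M] [ChartedSpace (EuclideanSpace ℝ (Fin m)) M]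

lemma contMDiffOn_partial_fderiv [IsManifold (𝓡 m) ∞ M]
    {W : Type} [NormedAddCommGroup W] [NormedSpace ℝ W]
    {U : Set E} (hU : IsOpen U) {F : E → M → W}
    (hF : ContMDiffOn (𝓘(ℝ, E).prod (𝓡 m)) 𝓘(ℝ, W) ∞ (Function.uncurry F) (U ×ˢ univ)) :
    ContMDiffOn (𝓘(ℝ, E).prod (𝓡 m)) 𝓘(ℝ, E →L[ℝ] W) ∞
      (Function.uncurry fun y x => fderiv ℝ (F · x) y) (U ×ˢ univ) := by
  rintro ⟨y, x⟩ hyx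
  have hF' : ContMDiffAt (𝓘(ℝ, E).prod (𝓡 m)) 𝓘(ℝ, W) ∞ (Function.uncurry F) (y, x) :=
    hF.contMDiffAt ((hU.prod isOpen_univ).mem_nhds hyx)
  refine ContMDiffAt.contMDiffWithinAt ?_
  have key := ContMDiffAt.mfderiv (I := 𝓘(ℝ, E)) (I' := 𝓘(ℝ, W)) (m := ∞) (n := ∞)
    (x₀ := (y, x)) (J := 𝓘(ℝ, E).prod (𝓡 m))
    (fun (p : E × M) z => F z p.2) (fun p : E × M => p.1) ?_ contMDiffAt_fst le_rfl
  · simp only [mfderiv_eq_fderiv] at key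
    have e := inTangentCoordinates_model_space (I := 𝓘(ℝ, E)) (I' := 𝓘(ℝ, W))
      (fun p : E × M => p.1) (fun p => F p.1 p.2) (fun p => fderiv ℝ (F · p.2) p.1) (y, x)
    have key' := key.congr_of_eventuallyEq (Eventually.of_forall fun p => (congrFun e p).symm)
    exact key'
  · refine ContMDiffAt.comp ((y, x), y) (g := Function.uncurry F)
      (f := fun q : (E × M) × E => (q.2, q.1.2)) hF' ?_
    exact contMDiffAt_snd.prodMk (contMDiffAt_snd.comp _ contMDiffAt_fst)

variable [FiniteDimensional ℝ E] [CompactSpace M] [SecondCountableTopology M]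
  [MeasurableSpace M] [BorelSpace M] {μ : Measure M}

/-- Dominated differentiation: the partial derivative is bounded by some `C` on the compact product
of a closed ball with `M`, so `‖w‖ * C` dominates. -/
lemma hasFDerivAt_integral_smul_of_contMDiffOn [IsManifold (𝓡 m) ∞ M]
    {W : Type} [NormedAddCommGroup W] [NormedSpace ℝ W]
    {U : Set E} (hU : IsOpen U) {F : E → M → W}
    (hF : ContMDiffOn (𝓘(ℝ, E).prod (𝓡 m)) 𝓘(ℝ, W) ∞ (Function.uncurry F) (U ×ˢ univ))
    {w : M → ℝ} (hw : Integrable w μ) {y₀ : E} (hy₀ : y₀ ∈ U) :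
    HasFDerivAt (fun y => ∫ x, w x • F y x ∂μ)
      (∫ x, w x • fderiv ℝ (F · x) y₀ ∂μ) y₀ := by
  have hF' := contMDiffOn_partial_fderiv hU hF
  have hcont {W' : Type} [NormedAddCommGroup W'] {H : E → M → W'}
      (hH : ContinuousOn (Function.uncurry H) (U ×ˢ univ)) {y : E} (hy : y ∈ U) :
      Continuous (H y) := by
    have h2 : Continuous fun x : M => (y, x) := by fun_prop
    exact hH.comp_continuous h2 fun x => ⟨hy, mem_univ _⟩
  obtain ⟨r, hr, hrU⟩ := Metric.nhds_basis_closedBall.mem_iff.1 (hU.mem_nhds hy₀)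
  have hKc : IsCompact (Metric.closedBall y₀ r ×ˢ (univ : Set M)) :=
    (isCompact_closedBall y₀ r).prod isCompact_univ
  have hK : ContinuousOn (Function.uncurry fun y x => fderiv ℝ (F · x) y)
      (Metric.closedBall y₀ r ×ˢ (univ : Set M)) :=
    hF'.continuousOn.mono (prod_mono hrU (subset_univ _))
  obtain ⟨C, hC⟩ := hKc.exists_bound_of_continuousOn hK
  obtain ⟨C₀, hC₀⟩ := isCompact_univ.exists_bound_of_continuousOn
    (hcont hF.continuousOn hy₀).continuousOn
  refine hasFDerivAt_integral_of_dominated_of_fderiv_le (𝕜 := ℝ)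
    (F' := fun y x => w x • fderiv ℝ (F · x) y)
    (bound := fun x => ‖w x‖ * C) (Metric.closedBall_mem_nhds y₀ hr) ?_ ?_ ?_ ?_ ?_ ?_
  · filter_upwards [hU.mem_nhds hy₀] with y hy
    exact hw.aestronglyMeasurable.smul (hcont hF.continuousOn hy).aestronglyMeasurable
  · have : Integrable (fun x => ‖w x‖ * C₀) μ := hw.norm.mul_const _
    refine this.mono' (hw.aestronglyMeasurable.smul
      (hcont hF.continuousOn hy₀).aestronglyMeasurable) (ae_of_all _ fun x => ?_)
    rw [norm_smul]
    exact mul_le_mul_of_nonneg_left (hC₀ x (mem_univ _)) (norm_nonneg _)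
  · exact hw.aestronglyMeasurable.smul (hcont hF'.continuousOn hy₀).aestronglyMeasurable
  · refine ae_of_all _ fun x y hy => ?_
    rw [norm_smul]
    exact mul_le_mul_of_nonneg_left (hC (y, x) ⟨hy, mem_univ _⟩) (norm_nonneg _)
  · exact hw.norm.mul_const _
  · refine ae_of_all _ fun x y hy => ?_
    have h1 : ContMDiffAt (𝓘(ℝ, E).prod (𝓡 m)) 𝓘(ℝ, W) ∞ (Function.uncurry F) (y, x) :=
      hF.contMDiffAt ((hU.prod isOpen_univ).mem_nhds ⟨hrU hy, mem_univ _⟩)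
    have h2 : ContMDiffAt 𝓘(ℝ, E) 𝓘(ℝ, W) ∞ (F · x) y :=
      h1.comp y (f := fun z => (z, x)) (contMDiffAt_id.prodMk contMDiffAt_const)
    exact (((contMDiffAt_iff_contDiffAt.1 h2).differentiableAt (by simp)).hasFDerivAt).const_smul
      (w x)

/-- Integrals of smooth functions of a parameter in a vector space and of a point of a compact
manifold, against an integrable weight, are smooth in the parameter. -/
lemma contDiffOn_integral_smul_of_contMDiffOn [IsManifold (𝓡 m) ∞ M]
    {U : Set E} (hU : IsOpen U) {w : M → ℝ} (hw : Integrable w μ) (k : ℕ) :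
    ∀ {W : Type} [NormedAddCommGroup W] [NormedSpace ℝ W] {F : E → M → W},
    ContMDiffOn (𝓘(ℝ, E).prod (𝓡 m)) 𝓘(ℝ, W) ∞ (Function.uncurry F) (U ×ˢ univ) →
    ContDiffOn ℝ k (fun y => ∫ x, w x • F y x ∂μ) U := by
  -- The target `W` varies in the induction, because the step applies the hypothesis to the partial
  -- derivative, which takes values in `E →L[ℝ] W`.
  induction k with
  | zero =>
    intro W _ _ F hF
    exact contDiffOn_zero.2 fun y hy =>
      (hasFDerivAt_integral_smul_of_contMDiffOn hU hF hw hy).continuousAt.continuousWithinAt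
  | succ k ih =>
    intro W _ _ F hF
    have hd := fun y (hy : y ∈ U) => hasFDerivAt_integral_smul_of_contMDiffOn (m := m) hU hF hw hy
    push_cast
    rw [contDiffOn_succ_iff_fderiv_of_isOpen hU]
    refine ⟨fun y hy => (hd y hy).differentiableAt.differentiableWithinAt, by simp, ?_⟩
    have hF' := contMDiffOn_partial_fderiv (m := m) hU hF
    exact (ih hF').congr fun y hy => (hd y hy).fderiv

/-- Integrals of smooth functions on a product of manifolds over one of the factors, against an
integrable weight, are smooth. -/
lemma contMDiff_integral_mul [IsManifold (𝓡 m) ∞ M] {n : ℕ} {N : Type*} [TopologicalSpace N]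
    [ChartedSpace (EuclideanSpace ℝ (Fin n)) N] [IsManifold (𝓡 n) ∞ N]
    {F : N → M → ℝ} (hF : ContMDiff ((𝓡 n).prod (𝓡 m)) 𝓘(ℝ, ℝ) ∞ (Function.uncurry F))
    {w : M → ℝ} (hw : Integrable w μ) :
    ContMDiff (𝓡 n) 𝓘(ℝ, ℝ) ∞ (fun y => ∫ x, w x * F y x ∂μ) := by
  intro y₀
  have hU : IsOpen (extChartAt (𝓡 n) y₀).target := isOpen_extChartAt_target y₀
  have h1 : ContDiffOn ℝ ∞
      (fun z => ∫ x, w x • F ((extChartAt (𝓡 n) y₀).symm z) x ∂μ)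
      (extChartAt (𝓡 n) y₀).target := by
    refine contDiffOn_infty.2 fun k => ?_
    refine contDiffOn_integral_smul_of_contMDiffOn (m := m) hU hw k
      (F := fun z x => F ((extChartAt (𝓡 n) y₀).symm z) x) ?_
    refine hF.comp_contMDiffOn (f := fun p : EuclideanSpace ℝ (Fin n) × M =>
      ((extChartAt (𝓡 n) y₀).symm p.1, p.2)) ?_
    refine ContMDiffOn.prodMk ?_ contMDiffOn_snd
    exact (contMDiffOn_extChartAt_symm y₀).comp contMDiffOn_fst fun p hp => hp.1
  have h2 : ContMDiffAt 𝓘(ℝ, EuclideanSpace ℝ (Fin n)) 𝓘(ℝ, ℝ) ∞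
      (fun z => ∫ x, w x • F ((extChartAt (𝓡 n) y₀).symm z) x ∂μ) (extChartAt (𝓡 n) y₀ y₀) :=
    ((h1.contDiffAt (hU.mem_nhds (mem_extChartAt_target y₀)))).contMDiffAt
  have h3 := h2.comp y₀ (contMDiffAt_extChartAt (I := 𝓡 n) (n := ∞) (x := y₀))
  refine h3.congr_of_eventuallyEq ?_
  filter_upwards [extChartAt_source_mem_nhds (I := 𝓡 n) y₀] with y hy
  simp only [Function.comp, (extChartAt (𝓡 n) y₀).left_inv hy, smul_eq_mul]

end ParametricIntegral

/-! ### Lipschitz constants and differentials on a Riemannian manifold -/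

section Riemannian

lemma mfderiv_extChartAt_symm_self {m : ℕ} {M : Type*} [TopologicalSpace M]
    [ChartedSpace (EuclideanSpace ℝ (Fin m)) M] [IsManifold (𝓡 m) ∞ M] (p : M) :
    mfderiv 𝓘(ℝ, EuclideanSpace ℝ (Fin m)) (𝓡 m) (extChartAt (𝓡 m) p).symm
      (extChartAt (𝓡 m) p p) = ContinuousLinearMap.id ℝ (EuclideanSpace ℝ (Fin m)) := by
  have := mfderivWithin_range_extChartAt_symm (I := 𝓡 m) (x := p)
  rwa [modelWithCornersSelf_coe, range_id, mfderivWithin_univ] at this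

/-- Every tangent vector is the velocity of a curve. -/
lemma exists_curve_mfderiv_eq {m : ℕ} {M : Type*} [TopologicalSpace M]
    [ChartedSpace (EuclideanSpace ℝ (Fin m)) M] [IsManifold (𝓡 m) ∞ M]
    (p : M) (v : EuclideanSpace ℝ (Fin m)) :
    ∃ γ : ℝ → M, γ 0 = p ∧ ContMDiffAt 𝓘(ℝ, ℝ) (𝓡 m) ∞ γ 0 ∧
      (mfderiv 𝓘(ℝ, ℝ) (𝓡 m) γ 0 (1 : ℝ) : EuclideanSpace ℝ (Fin m)) = v := by
  let e := extChartAt (𝓡 m) p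
  let a : ℝ → EuclideanSpace ℝ (Fin m) := fun t => e p + t • v
  have ha : HasFDerivAt a (ContinuousLinearMap.toSpanSingleton ℝ v) 0 := by
    have := ((hasDerivAt_id (0 : ℝ)).smul_const v).const_add (e p)
    rw [one_smul, hasDerivAt_iff_hasFDerivAt] at this
    exact this
  have ha0 : a 0 = e p := by simp [a]
  have hes : ContMDiffAt 𝓘(ℝ, EuclideanSpace ℝ (Fin m)) (𝓡 m) ∞ e.symm (a 0) := by
    rw [ha0]
    exact (contMDiffOn_extChartAt_symm p).contMDiffAt
      ((isOpen_extChartAt_target p).mem_nhds (mem_extChartAt_target p))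
  have hac : ContMDiffAt 𝓘(ℝ, ℝ) 𝓘(ℝ, EuclideanSpace ℝ (Fin m)) ∞ a 0 := by
    refine ContDiffAt.contMDiffAt ?_
    fun_prop
  refine ⟨e.symm ∘ a, ?_, hes.comp 0 hac, ?_⟩
  · simp [ha0, e]
  · rw [mfderiv_comp (I' := 𝓘(ℝ, EuclideanSpace ℝ (Fin m))) 0
      (hes.mdifferentiableAt (by simp)) (hac.mdifferentiableAt (by simp)), mfderiv_eq_fderiv,
      ha.fderiv]
    have key := mfderiv_extChartAt_symm_self (m := m) p
    rw [← show a 0 = extChartAt (𝓡 m) p p from ha0] at key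
    change mfderiv 𝓘(ℝ, EuclideanSpace ℝ (Fin m)) (𝓡 m) e.symm (a 0)
      (ContinuousLinearMap.toSpanSingleton ℝ v (1 : ℝ)) = v
    rw [show mfderiv 𝓘(ℝ, EuclideanSpace ℝ (Fin m)) (𝓡 m) e.symm (a 0) = _ from key]
    exact one_smul ℝ v

lemma mvfderiv_comp_curve {m : ℕ} {M : Type*} [TopologicalSpace M]
    [ChartedSpace (EuclideanSpace ℝ (Fin m)) M] {F : Type*} [NormedAddCommGroup F]
    [NormedSpace ℝ F] {f : M → F} {γ : ℝ → M} {t : ℝ}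
    (hf : MDifferentiableAt (𝓡 m) 𝓘(ℝ, F) f (γ t))
    (hγ : MDifferentiableAt 𝓘(ℝ, ℝ) (𝓡 m) γ t) :
    HasDerivAt (f ∘ γ) (mvfderiv (𝓡 m) f (γ t) (mfderiv 𝓘(ℝ, ℝ) (𝓡 m) γ t (1 : ℝ))) t := by
  have h : HasFDerivAt (f ∘ γ) (mfderiv 𝓘(ℝ, ℝ) 𝓘(ℝ, F) (f ∘ γ) t : ℝ →L[ℝ] F) t :=
    (hf.comp t hγ).hasMFDerivAt.hasFDerivAt
  have h' : (mfderiv 𝓘(ℝ, ℝ) 𝓘(ℝ, F) (f ∘ γ) t : ℝ →L[ℝ] F) (1 : ℝ) =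
      mvfderiv (𝓡 m) f (γ t) (mfderiv 𝓘(ℝ, ℝ) (𝓡 m) γ t (1 : ℝ)) := by
    rw [mfderiv_comp t hf hγ]
    rfl
  exact h' ▸ hasFDerivAt_iff_hasDerivAt.1 h

variable {m : ℕ} {M : Type*} [MetricSpace M]
    [ChartedSpace (EuclideanSpace ℝ (Fin m)) M]
    [RiemannianBundle (fun x : M => TangentSpace (𝓡 m) x)]
    [IsRiemannianManifold (𝓡 m) M]

open Manifold in
/-- A function on a Riemannian manifold whose differential has norm at most `K` everywhere is
`K`-Lipschitz. -/
lemma abs_sub_le_of_abs_mvfderiv_le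
    {f : M → ℝ} (hf : ContMDiff (𝓡 m) 𝓘(ℝ, ℝ) 1 f) {K : ℝ} (hK : 0 ≤ K)
    (h : ∀ (p : M) (v : TangentSpace (𝓡 m) p), |mvfderiv (𝓡 m) f p v| ≤ K * ‖v‖) (p q : M) :
    |f p - f q| ≤ K * dist p q := by
  lift K to NNReal using hK
  suffices H : edist (f q) (f p) ≤ K * edist p q by
    rw [edist_nndist, edist_nndist, ← ENNReal.coe_mul, ENNReal.coe_le_coe, nndist_comm] at H
    exact_mod_cast H
  rw [IsRiemannianManifold.out (I := 𝓡 m) p q]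
  have main : ∀ r, riemannianEDist (𝓡 m) p q < r → edist (f q) (f p) ≤ K * r := by
    intro r hr
    obtain ⟨γ, hγp, hγq, hγ, hlen⟩ := exists_lt_of_riemannianEDist_lt hr
    have hfγ : ContDiffOn ℝ 1 (f ∘ γ) (Icc 0 1) :=
      contMDiffOn_iff_contDiffOn.1 (hf.comp_contMDiffOn hγ)
    have h1 := enorm_sub_le_lintegral_deriv_of_contDiffOn_Icc hfγ zero_le_one
    rw [Function.comp, Function.comp, hγp, hγq, ← edist_eq_enorm_sub] at h1
    refine h1.trans (le_trans ?_ (mul_le_mul_right hlen.le _))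
    rw [pathELength_eq_lintegral_mfderiv_Icc, ← lintegral_const_mul' _ _ ENNReal.coe_ne_top,
      ← restrict_Ioo_eq_restrict_Icc]
    refine setLIntegral_mono' measurableSet_Ioo fun t ht => ?_
    have hγt : MDifferentiableAt 𝓘(ℝ, ℝ) (𝓡 m) γ t :=
      (hγ.contMDiffAt (Icc_mem_nhds ht.1 ht.2)).mdifferentiableAt one_ne_zero
    rw [(mvfderiv_comp_curve (hf.mdifferentiableAt one_ne_zero) hγt).deriv]
    have h2 := h (γ t) (mfderiv 𝓘(ℝ, ℝ) (𝓡 m) γ t (1 : ℝ))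
    rw [← Real.norm_eq_abs] at h2
    simp only [enorm, ← ENNReal.coe_mul, ENNReal.coe_le_coe]
    exact_mod_cast h2
  refine le_of_forall_gt_imp_ge_of_dense fun r hr => ?_
  -- For `K > 0` the radius `r / K` exceeds the distance. For `K = 0` any path of finite length
  -- suffices, and one exists because the distance is finite.
  by_cases hK0 : K = 0
  · subst hK0
    have hfin : riemannianEDist (𝓡 m) p q < ⊤ := by
      rw [← IsRiemannianManifold.out (I := 𝓡 m) p q]
      exact edist_lt_top p q
    obtain ⟨r', hr'⟩ := exists_between hfin
    have := main r' hr'.1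
    simp only [ENNReal.coe_zero, zero_mul] at this ⊢
    exact this.trans bot_le
  · have hK1 : (K : ENNReal) ≠ 0 := by exact_mod_cast hK0
    have := main (r / K) ((ENNReal.lt_div_iff_mul_lt (Or.inl hK1)
      (Or.inl ENNReal.coe_ne_top)).2 (by rwa [mul_comm]))
    rwa [ENNReal.mul_div_cancel hK1 ENNReal.coe_ne_top] at this

variable [IsManifold (𝓡 m) ∞ M]

open Manifold in
/-- At a point of a curve, the differential of a `K`-Lipschitz function stretches the velocity by
at most `K`. -/
lemma abs_mvfderiv_velocity_le [IsContMDiffRiemannianBundle (𝓡 m) ∞ (EuclideanSpace ℝ (Fin m))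
      (fun x : M => TangentSpace (𝓡 m) x)]
    {f : M → ℝ} {K : ℝ} (hK : 0 ≤ K) (h : ∀ p q, |f p - f q| ≤ K * dist p q)
    {γ : ℝ → M} (hγ : ContMDiffAt 𝓘(ℝ, ℝ) (𝓡 m) ∞ γ 0)
    (hf : MDifferentiableAt (𝓡 m) 𝓘(ℝ, ℝ) f (γ 0)) :
    |mvfderiv (𝓡 m) f (γ 0) (mfderiv 𝓘(ℝ, ℝ) (𝓡 m) γ 0 (1 : ℝ))| ≤
      K * ‖mfderiv 𝓘(ℝ, ℝ) (𝓡 m) γ 0 (1 : ℝ)‖ := by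
  have hγ1 : ContMDiffAt 𝓘(ℝ, ℝ) (𝓡 m) 1 γ 0 := hγ.of_le (by simp)
  obtain ⟨U, hU, hγU⟩ := (contMDiffAt_iff_contMDiffOn_nhds (by simp)).1 hγ1
  obtain ⟨δ, hδ, hδU⟩ := Metric.mem_nhds_iff.1 hU
  have hγB : ContMDiffOn 𝓘(ℝ, ℝ) (𝓡 m) 1 γ (Metric.ball 0 δ) := hγU.mono hδU
  -- Since the speed is continuous at `0`, it stays below `L + ε` near `0`. Thus `γ t` is within `(L
  -- + ε) * t` of `γ 0`, which bounds the difference quotients of `f ∘ γ`.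
  have hcont : ContinuousAt (fun t => ‖mfderiv 𝓘(ℝ, ℝ) (𝓡 m) γ t (1 : ℝ)‖) 0 := by
    have hmetric : IsContinuousRiemannianBundle (EuclideanSpace ℝ (Fin m))
        (fun x : M => TangentSpace (𝓡 m) x) := by
      obtain ⟨g, hg, hg'⟩ := IsContMDiffRiemannianBundle.exists_contMDiff (IB := 𝓡 m) (n := ∞)
        (F := EuclideanSpace ℝ (Fin m)) (E := fun x : M => TangentSpace (𝓡 m) x)
      exact ⟨g, hg.continuous, hg'⟩
    have hsec : ContinuousAt
        (fun t => (⟨γ t, mfderiv 𝓘(ℝ, ℝ) (𝓡 m) γ t (1 : ℝ)⟩ : TangentBundle (𝓡 m) M)) 0 := by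
      have h1 : ContinuousOn (tangentMap 𝓘(ℝ, ℝ) (𝓡 m) γ)
          (TotalSpace.proj ⁻¹' Metric.ball 0 δ) :=
        (hγB.continuousOn_tangentMapWithin le_rfl Metric.isOpen_ball.uniqueMDiffOn).congr
          fun x hx => (tangentMapWithin_eq_tangentMap
            (Metric.isOpen_ball.uniqueMDiffOn _ hx)
            ((hγB.contMDiffAt (Metric.isOpen_ball.mem_nhds hx)).mdifferentiableAt one_ne_zero)).symm
      have h2 : Continuous (fun t : ℝ => (⟨t, (1 : ℝ)⟩ : TangentBundle 𝓘(ℝ, ℝ) ℝ)) :=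
        (tangentBundleModelSpaceHomeomorph 𝓘(ℝ, ℝ)).symm.continuous.comp
          (Continuous.prodMk continuous_id continuous_const)
      have h3 : ContinuousOn (fun t => tangentMap 𝓘(ℝ, ℝ) (𝓡 m) γ ⟨t, (1 : ℝ)⟩)
          (Metric.ball 0 δ) := h1.comp h2.continuousOn fun t ht => ht
      exact h3.continuousAt (Metric.ball_mem_nhds 0 hδ)
    have := (ContinuousAt.inner_bundle hsec hsec).sqrt
    simpa only [norm_eq_sqrt_real_inner] using this
  have hd := mvfderiv_comp_curve hf (hγ.mdifferentiableAt (by simp))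
  set L := ‖mfderiv 𝓘(ℝ, ℝ) (𝓡 m) γ 0 (1 : ℝ)‖ with hL
  refine le_of_forall_gt_imp_ge_of_dense fun C hC => ?_
  obtain ⟨ε, hε, hεC⟩ : ∃ ε > 0, K * (L + ε) < C := by
    have : Tendsto (fun ε => K * (L + ε)) (𝓝[>] 0) (𝓝 (K * (L + 0))) := by
      refine Tendsto.mono_left ?_ nhdsWithin_le_nhds
      exact Continuous.tendsto (by fun_prop) 0
    rw [add_zero] at this
    have h1 := (this.eventually (gt_mem_nhds hC)).and self_mem_nhdsWithin
    obtain ⟨ε, h2, h3⟩ := h1.exists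
    exact ⟨ε, h3, h2⟩
  refine le_trans ?_ hεC.le
  have hev : ∀ᶠ t in 𝓝 (0 : ℝ), ‖mfderiv 𝓘(ℝ, ℝ) (𝓡 m) γ t (1 : ℝ)‖ < L + ε :=
    hcont.eventually (gt_mem_nhds (by linarith))
  obtain ⟨ρ, hρ, hρ'⟩ := Metric.eventually_nhds_iff_ball.1 hev
  have hbound : ∀ t ∈ Ioo 0 (min δ ρ), |f (γ t) - f (γ 0)| ≤ K * (L + ε) * t := by
    intro t ht
    have hsub : Icc 0 t ⊆ Metric.ball 0 δ := fun x hx => by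
      rw [Metric.mem_ball, dist_zero_right, Real.norm_eq_abs, abs_of_nonneg hx.1]
      exact (hx.2.trans_lt ht.2).trans_le (min_le_left _ _)
    have hlen : riemannianEDist (𝓡 m) (γ 0) (γ t) ≤ pathELength (𝓡 m) γ 0 t :=
      riemannianEDist_le_pathELength (hγB.mono hsub) rfl rfl ht.1.le
    have hlen2 : pathELength (𝓡 m) γ 0 t ≤ ENNReal.ofReal ((L + ε) * t) := by
      rw [pathELength_eq_lintegral_mfderiv_Icc]
      have : ENNReal.ofReal ((L + ε) * t) = ∫⁻ _ in Icc 0 t, ENNReal.ofReal (L + ε) := by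
        rw [lintegral_const, Measure.restrict_apply_univ, Real.volume_Icc, sub_zero,
          ENNReal.ofReal_mul (by positivity)]
      rw [this]
      refine setLIntegral_mono' measurableSet_Icc fun x hx => ?_
      rw [← ofReal_norm]
      refine ENNReal.ofReal_le_ofReal (hρ' x ?_).le
      rw [Metric.mem_ball, dist_zero_right, Real.norm_eq_abs, abs_of_nonneg hx.1]
      exact (hx.2.trans_lt ht.2).trans_le (min_le_right _ _)
    have hdist : dist (γ t) (γ 0) ≤ (L + ε) * t := by
      have hnn : 0 ≤ (L + ε) * t := mul_nonneg (by positivity) ht.1.le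
      rw [dist_comm, ← ENNReal.ofReal_le_ofReal_iff hnn, ← edist_dist,
        IsRiemannianManifold.out (I := 𝓡 m)]
      exact hlen.trans hlen2
    calc _ ≤ K * dist (γ t) (γ 0) := h _ _
      _ ≤ K * ((L + ε) * t) := mul_le_mul_of_nonneg_left hdist hK
      _ = _ := by ring
  have hslope := (hasDerivAt_iff_tendsto_slope_zero.1 hd).mono_left
    (nhdsWithin_mono 0 (fun x (hx : x ∈ Ioi 0) => (ne_of_gt hx : x ≠ 0)))
  refine le_of_tendsto hslope.abs ?_
  filter_upwards [Ioo_mem_nhdsGT (lt_min hδ hρ)] with t ht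
  have := hbound t ht
  simp only [zero_add, Function.comp, smul_eq_mul, abs_mul, abs_inv, abs_of_pos ht.1]
  rw [inv_mul_le_iff₀ ht.1]
  linarith

/-- The differential of a differentiable `K`-Lipschitz function on a Riemannian manifold has norm
at most `K`. -/
lemma abs_mvfderiv_le_of_lipschitz [IsContMDiffRiemannianBundle (𝓡 m) ∞
      (EuclideanSpace ℝ (Fin m)) (fun x : M => TangentSpace (𝓡 m) x)]
    {f : M → ℝ} {K : ℝ} (hK : 0 ≤ K) (h : ∀ p q, |f p - f q| ≤ K * dist p q) (p : M)
    (hf : MDifferentiableAt (𝓡 m) 𝓘(ℝ, ℝ) f p) (v : TangentSpace (𝓡 m) p) :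
    |mvfderiv (𝓡 m) f p v| ≤ K * ‖v‖ := by
  obtain ⟨γ, rfl, hγ, rfl⟩ := exists_curve_mfderiv_eq p v
  exact abs_mvfderiv_velocity_le hK h hγ hf

end Riemannian

/-! ### Local sections of submersions -/

section LocalSection

/-- A smooth map whose differential at a point is onto has a smooth local section through that
point. -/
lemma exists_local_section {n m : ℕ} {N M : Type*} [TopologicalSpace N]
    [ChartedSpace (EuclideanSpace ℝ (Fin n)) N] [IsManifold (𝓡 n) ∞ N] [TopologicalSpace M]
    [ChartedSpace (EuclideanSpace ℝ (Fin m)) M] [IsManifold (𝓡 m) ∞ M]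
    {η : N → M} {x : N} (hη : ContMDiffAt (𝓡 n) (𝓡 m) ∞ η x)
    (hsurj : Function.Surjective (mfderiv (𝓡 n) (𝓡 m) η x)) :
    ∃ σ : M → N, σ (η x) = x ∧ ContMDiffAt (𝓡 m) (𝓡 n) ∞ σ (η x) ∧
      ∀ᶠ q in 𝓝 (η x), η (σ q) = q := by
  let e := extChartAt (𝓡 n) x
  let e' := extChartAt (𝓡 m) (η x)
  let L : EuclideanSpace ℝ (Fin n) →L[ℝ] EuclideanSpace ℝ (Fin m) := mfderiv (𝓡 n) (𝓡 m) η x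
  have hL : HasFDerivAt (e' ∘ η ∘ e.symm) L (e x) := by
    have : HasFDerivWithinAt (e' ∘ η ∘ e.symm) L (range (𝓡 n)) (e x) :=
      (hη.mdifferentiableAt (by simp)).hasMFDerivAt.2
    rwa [modelWithCornersSelf_coe, range_id, hasFDerivWithinAt_univ] at this
  have hW : ContDiffAt ℝ ∞ (e' ∘ η ∘ e.symm) (e x) := by
    have := (contMDiffAt_iff.1 hη).2
    rw [modelWithCornersSelf_coe, range_id, contDiffWithinAt_univ] at this
    exact this
  -- Restricted to the affine slice through `e x` in the direction of a linear right inverse `S` of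
  -- `L`, the chart expression of `η` has derivative `L ∘ S = id`. Its local inverse `l` gives the
  -- section.
  obtain ⟨S, hS⟩ := (L : EuclideanSpace ℝ (Fin n) →ₗ[ℝ]
    EuclideanSpace ℝ (Fin m)).exists_rightInverse_of_surjective (LinearMap.range_eq_top.2 hsurj)
  let S' : EuclideanSpace ℝ (Fin m) →L[ℝ] EuclideanSpace ℝ (Fin n) := S.toContinuousLinearMap
  let a : EuclideanSpace ℝ (Fin m) → EuclideanSpace ℝ (Fin n) := fun y => e x + S' y
  have ha0 : a 0 = e x := by simp [a]
  have haC : ContDiff ℝ ∞ a := by fun_prop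
  have had : HasFDerivAt a S' 0 := S'.hasFDerivAt.const_add (e x)
  let k := (e' ∘ η ∘ e.symm) ∘ a
  have hk : ContDiffAt ℝ ∞ k 0 := by
    refine ContDiffAt.comp 0 ?_ haC.contDiffAt
    rwa [ha0]
  have hkd : HasFDerivAt k
      ((ContinuousLinearEquiv.refl ℝ (EuclideanSpace ℝ (Fin m)) :
        EuclideanSpace ℝ (Fin m) ≃L[ℝ] EuclideanSpace ℝ (Fin m)) :
        EuclideanSpace ℝ (Fin m) →L[ℝ] EuclideanSpace ℝ (Fin m)) 0 := by
    have h1 : HasFDerivAt k (L ∘L S') 0 := by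
      refine HasFDerivAt.comp 0 ?_ had
      rwa [ha0]
    convert h1 using 1
    ext1 v
    exact (LinearMap.congr_fun hS v).symm
  have hk0 : k 0 = e' (η x) := by simp [k, ha0, e]
  let l := hk.localInverse hkd (by simp)
  have hl0 : l (e' (η x)) = 0 := hk0 ▸ hk.localInverse_apply_image hkd (by simp)
  have hlC : ContDiffAt ℝ ∞ l (e' (η x)) := hk0 ▸ hk.to_localInverse hkd (by simp)
  have hlr : ∀ᶠ y in 𝓝 (e' (η x)), k (l y) = y :=
    hk0 ▸ (hk.hasStrictFDerivAt' hkd (by simp)).eventually_right_inverse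
  have hσ0 : e.symm (a (l (e' (η x)))) = x := by simp [hl0, ha0, e]
  have hσ : ContMDiffAt (𝓡 m) (𝓡 n) ∞ (fun q => e.symm (a (l (e' q)))) (η x) := by
    have h1 : ContMDiffAt 𝓘(ℝ, EuclideanSpace ℝ (Fin n)) (𝓡 n) ∞ e.symm
        (a (l (e' (η x)))) := by
      rw [hl0, ha0]
      exact (contMDiffOn_extChartAt_symm x).contMDiffAt
        ((isOpen_extChartAt_target x).mem_nhds (mem_extChartAt_target x))
    have h2 : ContMDiffAt 𝓘(ℝ, EuclideanSpace ℝ (Fin m)) 𝓘(ℝ, EuclideanSpace ℝ (Fin n)) ∞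
        (a ∘ l) (e' (η x)) := (haC.contDiffAt.comp _ hlC).contMDiffAt
    have h3 : ContMDiffAt (𝓡 m) 𝓘(ℝ, EuclideanSpace ℝ (Fin m)) ∞ e' (η x) :=
      contMDiffAt_extChartAt
    exact h1.comp (η x) (h2.comp (η x) h3)
  refine ⟨fun q => e.symm (a (l (e' q))), hσ0, hσ, ?_⟩
  have he'c : ContinuousAt e' (η x) := continuousAt_extChartAt (η x)
  have hηc : ContinuousAt (fun q => η (e.symm (a (l (e' q))))) (η x) := by
    refine ContinuousAt.comp (g := η) ?_ hσ.continuousAt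
    rw [hσ0]
    exact hη.continuousAt
  have hs1 : ∀ᶠ q in 𝓝 (η x), η (e.symm (a (l (e' q)))) ∈ e'.source := by
    refine hηc.eventually (?_ : ∀ᶠ y in 𝓝 (η (e.symm (a (l (e' (η x)))))), y ∈ e'.source)
    rw [hσ0]
    exact extChartAt_source_mem_nhds (η x)
  filter_upwards [hs1, extChartAt_source_mem_nhds (I := 𝓡 m) (η x), he'c.eventually hlr]
    with q h1 h2 h3
  exact e'.injOn h1 h2 h3

end LocalSection

/-! ### Irreducibility and orthogonal preimages -/

section LinearAlgebra

open scoped InnerProductSpace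

/-- A linear map on a finite dimensional Euclidean space such that the norm of the image is
invariant under an irreducible set of linear isometries is a homothety. -/
lemma exists_norm_eq_mul_norm_of_irreducible {E F : Type*} [NormedAddCommGroup E]
    [InnerProductSpace ℝ E] [FiniteDimensional ℝ E] [NormedAddCommGroup F]
    [InnerProductSpace ℝ F] [FiniteDimensional ℝ F] (L : E →ₗ[ℝ] F) (S : Set (E →ₗ[ℝ] E))
    (hiso : ∀ h ∈ S, ∀ v, ‖h v‖ = ‖v‖) (hinv : ∀ h ∈ S, ∀ v, ‖L (h v)‖ = ‖L v‖)
    (hirr : ∀ W : Submodule ℝ E, (∀ h ∈ S, ∀ v ∈ W, h v ∈ W) → W = ⊥ ∨ W = ⊤) :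
    ∃ κ : ℝ, 0 ≤ κ ∧ ∀ v, ‖L v‖ = κ * ‖v‖ := by
  rcases subsingleton_or_nontrivial E with hE | hE
  · exact ⟨0, le_rfl, fun v => by simp [Subsingleton.elim v 0]⟩
  let T : E →ₗ[ℝ] E := L.adjoint ∘ₗ L
  have hT : ∀ v w, ⟪T v, w⟫_ℝ = ⟪L v, L w⟫_ℝ := fun v w => by
    simp [T, LinearMap.adjoint_inner_left]
  have hsym : T.IsSymmetric := fun v w => by
    rw [hT, real_inner_comm _ v, hT, real_inner_comm]
  obtain ⟨μ, hμ⟩ : ∃ μ : ℝ, Module.End.HasEigenvalue T μ :=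
    ⟨_, hsym.hasEigenvalue_iSup_of_finiteDimensional⟩
  -- Polarization makes the form `⟪L v, L w⟫` invariant under `h`. As `h` is a surjective isometry,
  -- `T` commutes with it and the eigenspaces of `T` are invariant.
  have hcomm : ∀ h ∈ S, ∀ v, T (h v) = h (T v) := by
    intro h hh v
    let hi : E →ₗᵢ[ℝ] E := ⟨h, hiso h hh⟩
    have hpol : ∀ v w, ⟪L (h v), L (h w)⟫_ℝ = ⟪L v, L w⟫_ℝ := fun v w => by
      rw [real_inner_eq_norm_add_mul_self_sub_norm_mul_self_sub_norm_mul_self_div_two,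
        real_inner_eq_norm_add_mul_self_sub_norm_mul_self_sub_norm_mul_self_div_two, ← map_add,
        ← map_add, ← map_add, hinv h hh, hinv h hh, hinv h hh]
    have hsurj : Function.Surjective h := LinearMap.surjective_of_injective hi.injective
    refine ext_inner_right ℝ fun w => ?_
    obtain ⟨w, rfl⟩ := hsurj w
    rw [hT, hpol, ← hT]
    exact (hi.inner_map_map (T v) w).symm
  have htop : Module.End.eigenspace T μ = ⊤ := by
    refine (hirr _ fun h hh v hv => ?_).resolve_left hμ
    rw [Module.End.mem_eigenspace_iff] at hv ⊢
    rw [hcomm h hh, hv, map_smul]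
  have hTv : ∀ v, ‖L v‖ ^ 2 = μ * ‖v‖ ^ 2 := fun v => by
    have hv : v ∈ Module.End.eigenspace T μ := htop ▸ Submodule.mem_top
    rw [← real_inner_self_eq_norm_sq, ← hT, Module.End.mem_eigenspace_iff.1 hv,
      real_inner_smul_left, real_inner_self_eq_norm_sq]
  have hμ0 : 0 ≤ μ := by
    obtain ⟨v, hv⟩ := exists_ne (0 : E)
    have h1 : 0 < ‖v‖ ^ 2 := by positivity
    have h2 := hTv v
    by_contra hneg
    nlinarith [sq_nonneg ‖L v‖]
  refine ⟨√μ, Real.sqrt_nonneg _, fun v => ?_⟩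
  rw [← Real.sqrt_sq (norm_nonneg (L v)), hTv, Real.sqrt_mul hμ0, Real.sqrt_sq (norm_nonneg v)]

/-- A surjective linear map has a preimage of each vector orthogonal to the kernel. -/
lemma exists_orthogonal_ker_map_eq {E F : Type*} [NormedAddCommGroup E]
    [InnerProductSpace ℝ E] [FiniteDimensional ℝ E] [AddCommGroup F] [Module ℝ F]
    (L : E →ₗ[ℝ] F) (hL : Function.Surjective L) (v : F) :
    ∃ ξ : E, (∀ w, L w = 0 → ⟪ξ, w⟫_ℝ = 0) ∧ L ξ = v := by
  obtain ⟨x, rfl⟩ := hL v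
  obtain ⟨y, hy, z, hz, hxyz⟩ := (LinearMap.ker L).exists_add_mem_mem_orthogonal x
  refine ⟨z, fun w hw => ?_, ?_⟩
  · exact (Submodule.mem_orthogonal' _ _).1 hz w hw
  · rw [hxyz, map_add, LinearMap.mem_ker.1 hy, zero_add]

end LinearAlgebra

/-! ### Translations on `L²(M)` and smoothness of matrix coefficients -/

noncomputable section

section Translate

variable {G : Type*} [Group G] {M : Type*} [TopologicalSpace M] [MulAction G M]
  [ContinuousConstSMul G M] [MeasurableSpace M] [BorelSpace M]
  (μ : Measure M) [SMulInvariantMeasure G M μ]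

/-- The action of `g : G` on `L²(M)` by `u ↦ u ∘ g`. -/
def translateLp (g : G) : Lp ℝ 2 μ →ₗᵢ[ℝ] Lp ℝ 2 μ :=
  Lp.compMeasurePreservingₗᵢ ℝ (fun x : M => g • x) (measurePreserving_smul g μ)

variable {μ}

lemma coeFn_translateLp (g : G) (u : Lp ℝ 2 μ) : translateLp μ g u =ᵐ[μ] fun x => u (g • x) :=
  Lp.coeFn_compMeasurePreserving u (measurePreserving_smul g μ)

lemma translateLp_translateLp_inv (g : G) (u : Lp ℝ 2 μ) :
    translateLp μ g (translateLp μ g⁻¹ u) = u := by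
  refine Lp.ext ?_
  have h := (measurePreserving_smul g μ).quasiMeasurePreserving.ae (coeFn_translateLp g⁻¹ u)
  filter_upwards [coeFn_translateLp g (translateLp μ g⁻¹ u), h] with x h1 h2
  rw [h1, h2, inv_smul_smul]

lemma inner_translateLp_left (g : G) (u w : Lp ℝ 2 μ) :
    ⟪translateLp μ g u, w⟫_ℝ = ⟪u, translateLp μ g⁻¹ w⟫_ℝ := by
  conv_lhs => rw [← translateLp_translateLp_inv g w]
  exact (translateLp μ g).inner_map_map _ _

lemma IsInvariantSubspace.translateLp_mem {V : Submodule ℝ (Lp ℝ 2 μ)}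
    (hV : IsInvariantSubspace G V) (g : G) {u : Lp ℝ 2 μ} (hu : u ∈ V) : translateLp μ g u ∈ V :=
  hV g u hu _ (coeFn_translateLp g u)

/-- The expansion of a translate in an orthonormal basis of an invariant subspace. -/
lemma translateLp_ae_eq_sum
    {V : Submodule ℝ (Lp ℝ 2 μ)} [FiniteDimensional ℝ V] {ι : Type*} [Fintype ι]
    (b : OrthonormalBasis ι ℝ V)
    (hV : IsInvariantSubspace G V) {u : Lp ℝ 2 μ} (hu : u ∈ V) (g : G) :
    ∀ᵐ x ∂μ, u (g • x) =
      ∑ j, ⟪translateLp μ g u, (b j : Lp ℝ 2 μ)⟫_ℝ * (b j : Lp ℝ 2 μ) x := by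
  have h1 : translateLp μ g u =
      ∑ j, ⟪translateLp μ g u, (b j : Lp ℝ 2 μ)⟫_ℝ • (b j : Lp ℝ 2 μ) := by
    have := congrArg (Subtype.val) (b.sum_repr' ⟨translateLp μ g u, hV.translateLp_mem g hu⟩)
    rw [Submodule.coe_sum] at this
    refine this.symm.trans (Finset.sum_congr rfl fun j _ => ?_)
    rw [Submodule.coe_smul, Submodule.coe_inner, real_inner_comm]
  have h3 : ∀ᵐ x ∂μ, ∀ j,
      (⟪translateLp μ g u, (b j : Lp ℝ 2 μ)⟫_ℝ • (b j : Lp ℝ 2 μ) : Lp ℝ 2 μ) x =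
        ⟪translateLp μ g u, (b j : Lp ℝ 2 μ)⟫_ℝ * (b j : Lp ℝ 2 μ) x :=
    ae_all_iff.2 fun j => (Lp.coeFn_smul _ (b j : Lp ℝ 2 μ)).mono fun x hx => hx
  filter_upwards [coeFn_translateLp g u, h3, Lp.coeFn_fun_finsetSum Finset.univ
    fun j => ⟪translateLp μ g u, (b j : Lp ℝ 2 μ)⟫_ℝ • (b j : Lp ℝ 2 μ)] with x h4 h5 h6
  rw [← h4]
  conv_lhs => rw [h1]
  rw [h6]
  exact Finset.sum_congr rfl fun j _ => h5 j

end Translate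

section Coefficients

variable {n m : ℕ} {G : Type*} [Group G] [TopologicalSpace G]
  [ChartedSpace (EuclideanSpace ℝ (Fin n)) G] [LieGroup (𝓡 n) ∞ G]
  {M : Type*} [MetricSpace M] [CompactSpace M]
  [ChartedSpace (EuclideanSpace ℝ (Fin m)) M] [IsManifold (𝓡 m) ∞ M]
  [MulAction G M] [ContinuousConstSMul G M] [ContMDiffSMul (𝓡 n) (𝓡 m) ∞ G M]
  [MeasurableSpace M] [BorelSpace M] {μ : Measure M} [IsFiniteMeasure μ]

variable (m μ) in
/-- The classes of smooth functions are dense in `L²(M)`. -/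
lemma dense_toLp_contMDiff :
    Dense ((ContinuousMap.toLp 2 μ ℝ : C(M, ℝ) →L[ℝ] Lp ℝ 2 μ) ''
      {f : C(M, ℝ) | ContMDiff (𝓡 m) 𝓘(ℝ, ℝ) ∞ f}) := by
  refine (ContinuousMap.toLp_denseRange ℝ μ ℝ (by simp)).dense_image
    (ContinuousLinearMap.continuous _) ?_
  refine Metric.dense_iff.2 fun f r hr => ?_
  obtain ⟨g, hg, -⟩ := f.continuous.exists_contMDiff_approx (𝓡 m) ⊤
    (continuous_const (y := r / 2)) (fun _ => by positivity)
  refine ⟨⟨g, g.contMDiff.continuous⟩, ?_, g.contMDiff⟩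
  rw [Metric.mem_ball, ContinuousMap.dist_lt_iff hr]
  intro x
  exact (hg x).trans (by linarith)

variable [SMulInvariantMeasure G M μ]

lemma contMDiff_inner_translateLp_toLp {f : C(M, ℝ)} (hf : ContMDiff (𝓡 m) 𝓘(ℝ, ℝ) ∞ f)
    (w : Lp ℝ 2 μ) :
    ContMDiff (𝓡 n) 𝓘(ℝ, ℝ) ∞
      (fun g : G => ⟪translateLp μ g (ContinuousMap.toLp 2 μ ℝ f), w⟫_ℝ) := by
  have hw : Integrable w μ := (Lp.memLp w).integrable (by norm_num)
  have h := contMDiff_integral_mul (F := fun (g : G) (x : M) => f (g • x))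
    (hf.comp (contMDiff_smul (I := 𝓡 n) (I' := 𝓡 m))) hw
  refine h.congr fun g => ?_
  rw [L2.inner_def]
  refine integral_congr_ae ?_
  have h1 := (measurePreserving_smul g μ).quasiMeasurePreserving.ae
    (ContinuousMap.coeFn_toLp (p := 2) (𝕜 := ℝ) μ f)
  filter_upwards [coeFn_translateLp g (ContinuousMap.toLp 2 μ ℝ f), h1] with x h2 h3
  rw [h2, h3]
  simp

end Coefficients

/-- The matrix coefficients of a finite dimensional invariant subspace of `L²(M)` are smooth. -/
lemma contMDiff_inner_translateLp {n : ℕ} (m : ℕ) {G : Type*} [Group G] [TopologicalSpace G]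
    [ChartedSpace (EuclideanSpace ℝ (Fin n)) G] [LieGroup (𝓡 n) ∞ G]
    {M : Type*} [MetricSpace M] [CompactSpace M]
    [ChartedSpace (EuclideanSpace ℝ (Fin m)) M] [IsManifold (𝓡 m) ∞ M]
    [MulAction G M] [ContinuousConstSMul G M] [ContMDiffSMul (𝓡 n) (𝓡 m) ∞ G M]
    [MeasurableSpace M] [BorelSpace M] {μ : Measure M} [IsFiniteMeasure μ]
    [SMulInvariantMeasure G M μ] {V : Submodule ℝ (Lp ℝ 2 μ)} [FiniteDimensional ℝ V]
    (hV : IsInvariantSubspace G V) (u : V) (w : V) : ContMDiff (𝓡 n) 𝓘(ℝ, ℝ) ∞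
      (fun g : G => ⟪translateLp μ g (u : Lp ℝ 2 μ), (w : Lp ℝ 2 μ)⟫_ℝ) := by
  let A : Submodule ℝ (Lp ℝ 2 μ) :=
    { carrier := {v | ∀ w : Lp ℝ 2 μ, ContMDiff (𝓡 n) 𝓘(ℝ, ℝ) ∞
        (fun g : G => ⟪translateLp μ g v, w⟫_ℝ)}
      add_mem' := fun {a b} ha hb w => by
        simp only [map_add, inner_add_left]
        exact (ha w).add (hb w)
      zero_mem' := fun w => by
        simp only [map_zero, inner_zero_left]
        exact contMDiff_const
      smul_mem' := fun c a ha w => by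
        simp only [map_smul, real_inner_smul_left]
        exact contMDiff_const.mul (ha w) }
  have hA : Dense (A : Set (Lp ℝ 2 μ)) := by
    refine (dense_toLp_contMDiff m μ).mono ?_
    rintro _ ⟨f, hf, rfl⟩ w
    exact contMDiff_inner_translateLp_toLp (m := m) hf w
  let P : Lp ℝ 2 μ →L[ℝ] V := V.orthogonalProjectionOnto
  have hPs : Function.Surjective P := fun v => ⟨v, V.orthogonalProjectionOnto_mem_subspace_eq_self v⟩
  -- A dense subspace of the finite dimensional `V` is all of `V`. Hence `u` is the projection of a
  -- vector with smooth coefficients, and projecting does not change coefficients against `w`,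
  -- because the translates of `w` stay in `V`.
  have hmap : A.map (P : Lp ℝ 2 μ →ₗ[ℝ] V) = ⊤ := by
    have h1 : Dense ((A.map (P : Lp ℝ 2 μ →ₗ[ℝ] V) : Submodule ℝ V) : Set V) := by
      rw [Submodule.map_coe]
      exact hPs.denseRange.dense_image P.continuous hA
    have h2 := Submodule.closed_of_finiteDimensional (A.map (P : Lp ℝ 2 μ →ₗ[ℝ] V))
    exact SetLike.coe_injective (by rw [← h2.closure_eq, h1.closure_eq]; rfl)
  obtain ⟨v, hv, hvu⟩ := hmap ▸ Submodule.mem_top (x := u)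
  refine (hv w).congr fun g => ?_
  have h3 : translateLp μ g⁻¹ (w : Lp ℝ 2 μ) ∈ V := hV.translateLp_mem g⁻¹ w.2
  rw [inner_translateLp_left, inner_translateLp_left, ← hvu]
  exact V.inner_orthogonalProjectionOnto_eq_of_mem_right ⟨_, h3⟩ v

end

/-! ### Smooth representatives -/

section Representative

variable {n m : ℕ} {G : Type*} [Group G] [TopologicalSpace G]
  [ChartedSpace (EuclideanSpace ℝ (Fin n)) G] [LieGroup (𝓡 n) ∞ G]
  {M : Type*} [MetricSpace M] [ChartedSpace (EuclideanSpace ℝ (Fin m)) M] [MulAction G M]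

/-- A function on a homogeneous space is smooth if its composition with an orbit map is, provided
that the orbit maps have smooth local sections. -/
lemma contMDiff_of_contMDiff_orbit [MulAction.IsPretransitive G M]
    (hsec : ∀ p : M, ∃ σ : M → G, σ p = 1 ∧ ContMDiffAt (𝓡 m) (𝓡 n) ∞ σ p ∧
      ∀ᶠ q in 𝓝 p, σ q • p = q)
    {f : M → ℝ} {p : M} (hf : ContMDiff (𝓡 n) 𝓘(ℝ, ℝ) ∞ fun g : G => f (g • p)) :
    ContMDiff (𝓡 m) 𝓘(ℝ, ℝ) ∞ f := by
  intro q
  obtain ⟨g, rfl⟩ := MulAction.exists_smul_eq G p q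
  obtain ⟨σ, -, hσ, hσq⟩ := hsec (g • p)
  have h1 : ContMDiffAt (𝓡 m) (𝓡 n) ∞ (fun q => σ q * g) (g • p) := hσ.mul contMDiffAt_const
  refine (hf.contMDiffAt.comp _ h1).congr_of_eventuallyEq ?_
  filter_upwards [hσq] with q hq
  simp only [Function.comp, mul_smul, hq]

/-- A measurable function on a homogeneous space whose composition with an orbit map agrees almost
everywhere with a smooth function agrees almost everywhere with a smooth function. -/
lemma exists_contMDiff_ae_eq_of_orbit [MulAction.IsPretransitive G M] [T2Space G] [CompactSpace G]
    [SecondCountableTopology G] [IsTopologicalGroup G] [MeasurableSpace G] [BorelSpace G]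
    [CompactSpace M] [ContinuousSMul G M] [MeasurableSpace M] [BorelSpace M]
    {μ : Measure M} [IsProbabilityMeasure μ] [SMulInvariantMeasure G M μ]
    (ν : Measure G) [ν.IsHaarMeasure]
    (hsec : ∀ p : M, ∃ σ : M → G, σ p = 1 ∧ ContMDiffAt (𝓡 m) (𝓡 n) ∞ σ p ∧
      ∀ᶠ q in 𝓝 p, σ q • p = q)
    {u : M → ℝ} (hum : Measurable u) {F : G → ℝ} (hF : ContMDiff (𝓡 n) 𝓘(ℝ, ℝ) ∞ F) {x₀ : M}
    (hx₀ : ∀ᵐ g ∂ν, u (g • x₀) = F g) :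
    ∃ f : M → ℝ, ContMDiff (𝓡 m) 𝓘(ℝ, ℝ) ∞ f ∧ f =ᵐ[μ] u := by
  have hsmul : Measurable fun p : G × M => p.1 • p.2 := continuous_smul.measurable
  -- The invariance holds almost everywhere because right translations preserve null sets, then
  -- everywhere by continuity of `F`.
  have hFinv : ∀ h : G, h • x₀ = x₀ → ∀ g, F (g * h) = F g := by
    intro h hh
    have h1 := (quasiMeasurePreserving_mul_right ν h).ae hx₀
    have h2 : (fun g => F (g * h)) =ᵐ[ν] F := by
      filter_upwards [h1, hx₀] with g h3 h4
      rw [mul_smul, hh] at h3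
      exact h3.symm.trans h4
    exact congrFun (Continuous.ae_eq_iff_eq ν (hF.continuous.comp (continuous_mul_const h))
      hF.continuous |>.1 h2)
  -- The choice `τ` need not be continuous: by `hFinv` the value `F (τ q)` does not depend on it.
  choose τ hτ using fun q : M => MulAction.exists_smul_eq G x₀ q
  have hfF : ∀ g : G, F (τ (g • x₀)) = F g := by
    intro g
    have := hFinv (g⁻¹ * τ (g • x₀)) (by rw [mul_smul, hτ, inv_smul_smul]) g
    rw [← this, mul_inv_cancel_left]
  have hfs : ContMDiff (𝓡 m) 𝓘(ℝ, ℝ) ∞ fun q => F (τ q) :=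
    contMDiff_of_contMDiff_orbit hsec (p := x₀) (hF.congr hfF)
  refine ⟨fun q => F (τ q), hfs, ?_⟩
  have hall : ∀ᵐ x ∂μ, ∀ᵐ g ∂ν, F (τ (g • x)) = u (g • x) := by
    refine ae_of_all _ fun x => ?_
    obtain ⟨h, rfl⟩ := MulAction.exists_smul_eq G x₀ x
    have h1 : ∀ᵐ g ∂ν, F (τ (g • x₀)) = u (g • x₀) := by
      filter_upwards [hx₀] with g hg
      rw [hfF, hg]
    filter_upwards [(quasiMeasurePreserving_mul_right ν h).ae h1] with g hg
    rwa [mul_smul] at hg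
  -- Exchanging the quantifiers yields one `g` for which the identity holds at `g • x` for almost
  -- every `x`. Invariance of `μ` then removes `g`.
  have hall' := (Measure.ae_ae_comm (p := fun (x : M) (g : G) => F (τ (g • x)) = u (g • x))
    (measurableSet_eq_fun ((hfs.continuous.measurable.comp hsmul).comp measurable_swap)
      ((hum.comp hsmul).comp measurable_swap))).1 hall
  obtain ⟨g, hg⟩ := hall'.exists
  filter_upwards [(measurePreserving_smul g⁻¹ μ).quasiMeasurePreserving.ae hg] with x hx
  rwa [smul_inv_smul] at hx

variable [CompactSpace M] [IsManifold (𝓡 m) ∞ M] [ContMDiffSMul (𝓡 n) (𝓡 m) ∞ G M]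
  [T2Space G] [CompactSpace G] [MulAction.IsPretransitive G M] [MeasurableSpace M]
  [BorelSpace M] {μ : Measure M} [IsProbabilityMeasure μ] [SMulInvariantMeasure G M μ]
  [ContinuousConstSMul G M]

/-- The elements of a finite dimensional invariant subspace of `L²(M)` are represented by smooth
functions. -/
lemma exists_contMDiff_ae_eq
    (hsec : ∀ p : M, ∃ σ : M → G, σ p = 1 ∧ ContMDiffAt (𝓡 m) (𝓡 n) ∞ σ p ∧
      ∀ᶠ q in 𝓝 p, σ q • p = q)
    {V : Submodule ℝ (Lp ℝ 2 μ)} [FiniteDimensional ℝ V]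
    (hV : IsInvariantSubspace G V) {u : Lp ℝ 2 μ} (hu : u ∈ V) :
    ∃ f : M → ℝ, ContMDiff (𝓡 m) 𝓘(ℝ, ℝ) ∞ f ∧ f =ᵐ[μ] u := by
  let _ : MeasurableSpace G := borel G
  have : BorelSpace G := ⟨rfl⟩
  have : IsTopologicalGroup G := topologicalGroup_of_lieGroup (𝓡 n) ∞
  have : SecondCountableTopology G :=
    ChartedSpace.secondCountable_of_sigmaCompact (EuclideanSpace ℝ (Fin n)) G
  have : ContinuousSMul G M := ContMDiffSMul.continuousSMul (I := 𝓡 n) (I' := 𝓡 m) ∞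
  let b := stdOrthonormalBasis ℝ V
  let a : Fin (Module.finrank ℝ V) → G → ℝ :=
    fun j g => ⟪translateLp μ g u, (b j : Lp ℝ 2 μ)⟫_ℝ
  have ha : ∀ j, ContMDiff (𝓡 n) 𝓘(ℝ, ℝ) ∞ (a j) := fun j =>
    contMDiff_inner_translateLp m hV ⟨u, hu⟩ (b j)
  have hum : Measurable (u : M → ℝ) := (Lp.stronglyMeasurable u).measurable
  have hbm : ∀ j, Measurable (b j : M → ℝ) := fun j => (Lp.stronglyMeasurable _).measurable
  -- For each `g` the expansion holds for almost every `x`, with a null set depending on `g`. Fubini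
  -- provides a point `x₀` good for almost every `g`; there the right side is a smooth function of
  -- `g`.
  have hswap : ∀ᵐ x ∂μ, ∀ᵐ g ∂(Measure.haar : Measure G),
      u (g • x) = ∑ j, a j g * (b j : Lp ℝ 2 μ) x := by
    refine (Measure.ae_ae_comm ?_).1 (ae_of_all _ fun g => translateLp_ae_eq_sum b hV hu g)
    refine measurableSet_eq_fun (hum.comp continuous_smul.measurable) ?_
    refine Finset.measurable_sum _ fun j _ => ?_
    exact ((ha j).continuous.measurable.comp measurable_fst).mul ((hbm j).comp measurable_snd)
  obtain ⟨x₀, hx₀⟩ := hswap.exists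
  exact exists_contMDiff_ae_eq_of_orbit Measure.haar hsec hum
    (contMDiff_finsetSum fun j _ => (ha j).mul contMDiff_const) hx₀

end Representative

/-! ### Evaluation vectors -/

section ContRep

variable {M : Type*} [TopologicalSpace M] [MeasurableSpace M] {μ : Measure M}

lemma contRep_spec {u : Lp ℝ 2 μ} (h : ∃ f : M → ℝ, Continuous f ∧ f =ᵐ[μ] u) :
    Continuous (contRep u) ∧ contRep u =ᵐ[μ] u := by
  rw [contRep, dif_pos h]
  exact h.choose_spec

variable [μ.IsOpenPosMeasure]

/-- Continuous functions that agree almost everywhere for a measure of full support are equal, so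
the choice in `contRep` is harmless. -/
lemma contRep_eq {u : Lp ℝ 2 μ} {f : M → ℝ} (hf : Continuous f) (hfu : f =ᵐ[μ] u) :
    contRep u = f := by
  have h := contRep_spec ⟨f, hf, hfu⟩
  exact Measure.eq_of_ae_eq (h.2.trans hfu.symm) h.1 hf

variable {V : Submodule ℝ (Lp ℝ 2 μ)}

lemma contRep_add (hrep : ∀ u ∈ V, Continuous (contRep u) ∧ contRep u =ᵐ[μ] u)
    (u v : V) : contRep ((u + v : V) : Lp ℝ 2 μ) =
      fun p => contRep (u : Lp ℝ 2 μ) p + contRep (v : Lp ℝ 2 μ) p := by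
  refine contRep_eq ((hrep u u.2).1.add (hrep v v.2).1) ?_
  filter_upwards [(hrep u u.2).2, (hrep v v.2).2, Lp.coeFn_add (u : Lp ℝ 2 μ) v] with x h1 h2 h3
  rw [h1, h2, Submodule.coe_add, h3, Pi.add_apply]

lemma contRep_smul (hrep : ∀ u ∈ V, Continuous (contRep u) ∧ contRep u =ᵐ[μ] u)
    (c : ℝ) (u : V) : contRep ((c • u : V) : Lp ℝ 2 μ) =
      fun p => c * contRep (u : Lp ℝ 2 μ) p := by
  refine contRep_eq (continuous_const.mul (hrep u u.2).1) ?_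
  filter_upwards [(hrep u u.2).2, Lp.coeFn_smul c (u : Lp ℝ 2 μ)] with x h1 h3
  rw [h1, Submodule.coe_smul, h3, Pi.smul_apply, smul_eq_mul]

/-- The vector `φ_p` represents the evaluation at `p`. -/
lemma inner_evalVec [FiniteDimensional ℝ V]
    (hrep : ∀ u ∈ V, Continuous (contRep u) ∧ contRep u =ᵐ[μ] u) (p : M) (u : V) :
    ⟪u, evalVec V p⟫_ℝ = contRep (u : Lp ℝ 2 μ) p := by
  have h : ∃ φ : V, ∀ u : V, ⟪u, φ⟫_ℝ = contRep (u : Lp ℝ 2 μ) p := by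
    let l : V →ₗ[ℝ] ℝ :=
      { toFun := fun u => contRep (u : Lp ℝ 2 μ) p
        map_add' := fun u v => congrFun (contRep_add hrep u v) p
        map_smul' := fun c u => congrFun (contRep_smul hrep c u) p }
    refine ⟨(InnerProductSpace.toDual ℝ V).symm l.toContinuousLinearMap, fun u => ?_⟩
    rw [real_inner_comm, InnerProductSpace.toDual_symm_apply]
    rfl
  rw [evalVec, dif_pos h]
  exact h.choose_spec u

lemma evalVec_eq_sum [FiniteDimensional ℝ V]
    (hrep : ∀ u ∈ V, Continuous (contRep u) ∧ contRep u =ᵐ[μ] u)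
    {ι : Type*} [Fintype ι] (b : OrthonormalBasis ι ℝ V) (p : M) :
    evalVec V p = ∑ i, contRep (b i : Lp ℝ 2 μ) p • b i := by
  rw [← b.sum_repr' (evalVec V p)]
  exact Finset.sum_congr rfl fun i _ => by rw [inner_evalVec hrep]

lemma contMDiff_evalVec {m : ℕ} [ChartedSpace (EuclideanSpace ℝ (Fin m)) M]
    [FiniteDimensional ℝ V]
    (hrep : ∀ u ∈ V, ContMDiff (𝓡 m) 𝓘(ℝ, ℝ) ∞ (contRep u) ∧ contRep u =ᵐ[μ] u) :
    ContMDiff (𝓡 m) 𝓘(ℝ, V) ∞ (evalVec V) := by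
  have h : ContMDiff (𝓡 m) 𝓘(ℝ, V) ∞
      fun p => ∑ i, contRep (stdOrthonormalBasis ℝ V i : Lp ℝ 2 μ) p •
        stdOrthonormalBasis ℝ V i :=
    contMDiff_finsetSum fun i _ => (hrep _ (stdOrthonormalBasis ℝ V i).2).1.smul contMDiff_const
  exact h.congr fun p => evalVec_eq_sum (fun u hu => ⟨(hrep u hu).1.continuous, (hrep u hu).2⟩) _ p

end ContRep

/-! ### Equivariance of the evaluation vectors -/

noncomputable section

section Equivariance

variable {G : Type*} [Group G] {M : Type*} [TopologicalSpace M] [MulAction G M]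
  [ContinuousConstSMul G M] [MeasurableSpace M] [BorelSpace M]
  {μ : Measure M} [SMulInvariantMeasure G M μ] {V : Submodule ℝ (Lp ℝ 2 μ)}

/-- The orthogonal representation `u ↦ u ∘ g⁻¹` of `G` on an invariant subspace of `L²(M)`. -/
def translateRep (hV : IsInvariantSubspace G V) (g : G) : V →ₗᵢ[ℝ] V where
  toLinearMap := (translateLp μ g⁻¹).toLinearMap.restrict fun _ hu => hV.translateLp_mem g⁻¹ hu
  norm_map' u := (translateLp μ g⁻¹).norm_map u

lemma inner_translateRep_right (hV : IsInvariantSubspace G V) (g : G) (u w : V) :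
    ⟪u, translateRep hV g w⟫_ℝ = ⟪translateLp μ g u, (w : Lp ℝ 2 μ)⟫_ℝ := by
  rw [inner_translateLp_left]
  rfl

variable [μ.IsOpenPosMeasure]

lemma contRep_translateLp
    (hrep : ∀ u ∈ V, Continuous (contRep u) ∧ contRep u =ᵐ[μ] u) (g : G) (u : V) :
    contRep (translateLp μ g u) = fun q => contRep (u : Lp ℝ 2 μ) (g • q) := by
  refine contRep_eq ((hrep u u.2).1.comp (continuous_const_smul g)) ?_
  filter_upwards [coeFn_translateLp g (u : Lp ℝ 2 μ),
    (measurePreserving_smul g μ).quasiMeasurePreserving.ae (hrep u u.2).2] with x h1 h2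
  rw [h1, h2]

/-- Pairing either side with `u` gives `u(g p)`, which is also the value at `p` of the translate `u
∘ g`. -/
lemma evalVec_smul [FiniteDimensional ℝ V] (hV : IsInvariantSubspace G V)
    (hrep : ∀ u ∈ V, Continuous (contRep u) ∧ contRep u =ᵐ[μ] u) (g : G) (p : M) :
    evalVec V (g • p) = translateRep hV g (evalVec V p) := by
  refine ext_inner_left ℝ fun u => ?_
  have h := congrFun (contRep_translateLp hrep g u) p
  rw [inner_evalVec hrep, inner_translateRep_right, ← h]
  exact (inner_evalVec hrep p ⟨translateLp μ g u, hV.translateLp_mem g u.2⟩).symm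

/-- All vectors `φ_p` have the same norm, the square root of the dimension. -/
lemma norm_evalVec [FiniteDimensional ℝ V] [MulAction.IsPretransitive G M]
    [IsProbabilityMeasure μ] (hV : IsInvariantSubspace G V)
    (hrep : ∀ u ∈ V, Continuous (contRep u) ∧ contRep u =ᵐ[μ] u) (p : M) :
    ‖evalVec V p‖ = √(Module.finrank ℝ V : ℝ) := by
  let b := stdOrthonormalBasis ℝ V
  have hconst : ∀ q, ‖evalVec V q‖ = ‖evalVec V p‖ := fun q => by
    obtain ⟨g, rfl⟩ := MulAction.exists_smul_eq G p q
    rw [evalVec_smul hV hrep, LinearIsometry.norm_map]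
  have hsq : ∀ q, ‖evalVec V q‖ ^ 2 = ∑ i, contRep (b i : Lp ℝ 2 μ) q ^ 2 := fun q => by
    rw [← b.sum_sq_norm_inner_right (evalVec V q)]
    exact Finset.sum_congr rfl fun i _ => by rw [inner_evalVec hrep, Real.norm_eq_abs, sq_abs]
  have hint : ∀ i, ∫ q, contRep (b i : Lp ℝ 2 μ) q ^ 2 ∂μ = 1 ∧
      Integrable (fun q => contRep (b i : Lp ℝ 2 μ) q ^ 2) μ := fun i => by
    have h1 : (fun q => contRep (b i : Lp ℝ 2 μ) q ^ 2) =ᵐ[μ] fun q => (b i : Lp ℝ 2 μ) q ^ 2 :=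
      (hrep _ (b i).2).2.mono fun q hq => by simp only [hq]
    have h2 : ⟪(b i : Lp ℝ 2 μ), (b i : Lp ℝ 2 μ)⟫_ℝ = 1 := by
      have := b.orthonormal.1 i
      rw [real_inner_self_eq_norm_sq]
      have h3 : ‖(b i : Lp ℝ 2 μ)‖ = 1 := this
      rw [h3, one_pow]
    constructor
    · rw [integral_congr_ae h1, ← h2, L2.inner_def]
      simp [sq]
    · exact (Lp.memLp (b i : Lp ℝ 2 μ)).integrable_sq.congr h1.symm
  -- The constant function `|φ_q|² = ∑ b_i(q)²` has integral `dim V`, one for each unit vector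
  -- `b_i`, and `μ` has mass one.
  have h : ‖evalVec V p‖ ^ 2 = Module.finrank ℝ V := by
    calc ‖evalVec V p‖ ^ 2 = ∫ q, ‖evalVec V q‖ ^ 2 ∂μ := by simp [hconst]
      _ = ∫ q, ∑ i, contRep (b i : Lp ℝ 2 μ) q ^ 2 ∂μ := by simp_rw [hsq]
      _ = ∑ i, ∫ q, contRep (b i : Lp ℝ 2 μ) q ^ 2 ∂μ :=
        integral_finsetSum _ fun i _ => (hint i).2
      _ = Module.finrank ℝ V := by simp [fun i => (hint i).1]
  rw [← h, Real.sqrt_sq (norm_nonneg _)]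

end Equivariance

end

/-! ### Equivariant maps of isotropy irreducible spaces -/

section Homothety

variable {m : ℕ} {G : Type*} [Group G] {M : Type*} [TopologicalSpace M]
  [ChartedSpace (EuclideanSpace ℝ (Fin m)) M]
  [MulAction G M] {E : Type*} [NormedAddCommGroup E] [InnerProductSpace ℝ E]
  {φ : M → E} {R : G → E →ₗᵢ[ℝ] E}

/-- Both sides are the derivative of `φ ∘ g = R g ∘ φ`, by the chain rule and the linearity of `R
g`. -/
lemma mvfderiv_equivariant (hg : ∀ g : G, ContMDiff (𝓡 m) (𝓡 m) ∞ fun x : M => g • x)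
    (hφ : ContMDiff (𝓡 m) 𝓘(ℝ, E) ∞ φ) (hR : ∀ g p, φ (g • p) = R g (φ p)) (g : G) (p : M)
    (v : TangentSpace (𝓡 m) p) :
    mvfderiv (𝓡 m) φ (g • p) (mfderiv (𝓡 m) (𝓡 m) (fun x : M => g • x) p v) =
      R g (mvfderiv (𝓡 m) φ p v) := by
  have hφd : MDifferentiable (𝓡 m) 𝓘(ℝ, E) φ := hφ.mdifferentiable (by simp)
  have h1 : mfderiv (𝓡 m) 𝓘(ℝ, E) (φ ∘ fun x : M => g • x) p v =
      mvfderiv (𝓡 m) φ (g • p) (mfderiv (𝓡 m) (𝓡 m) (fun x : M => g • x) p v) := by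
    rw [mfderiv_comp p (hφd _) ((hg g).mdifferentiableAt (by simp))]
    rfl
  have h2 : mfderiv (𝓡 m) 𝓘(ℝ, E) (R g ∘ φ) p v = R g (mvfderiv (𝓡 m) φ p v) := by
    have hRd : HasMFDerivAt 𝓘(ℝ, E) 𝓘(ℝ, E) (R g) (φ p) (R g).toContinuousLinearMap :=
      (R g).toContinuousLinearMap.hasFDerivAt.hasMFDerivAt
    rw [(hRd.comp p (hφd p).hasMFDerivAt).mfderiv]
    rfl
  rw [← h1, ← h2]
  exact congrArg (fun f => mfderiv (𝓡 m) 𝓘(ℝ, E) f p v) (funext fun x => hR g x)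

variable [RiemannianBundle (fun x : M => TangentSpace (𝓡 m) x)]

instance (p : M) : FiniteDimensional ℝ (TangentSpace (𝓡 m) p) :=
  inferInstanceAs (FiniteDimensional ℝ (EuclideanSpace ℝ (Fin m)))

lemma ActsByIsometries.surjective (hiso : ActsByIsometries m G M) (g : G) (p : M) :
    Function.Surjective (mfderiv (𝓡 m) (𝓡 m) (fun x : M => g • x) p) := by
  have hinj : Function.Injective (mfderiv (𝓡 m) (𝓡 m) (fun x : M => g • x) p) := by
    refine (injective_iff_map_eq_zero _).2 fun v hv => ?_
    rw [← norm_eq_zero, ← hiso g p v, hv, norm_zero]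
  let A : EuclideanSpace ℝ (Fin m) →L[ℝ] EuclideanSpace ℝ (Fin m) :=
    mfderiv (𝓡 m) (𝓡 m) (fun x : M => g • x) p
  exact (LinearMap.injective_iff_surjective (f := A.toLinearMap)).1 hinj

/-- An equivariant smooth map of an isotropy irreducible space into a Euclidean space is a
homothety. -/
lemma exists_norm_mvfderiv_eq [MulAction.IsPretransitive G M] [FiniteDimensional ℝ E]
    (hg : ∀ g : G, ContMDiff (𝓡 m) (𝓡 m) ∞ fun x : M => g • x)
    (hiso : ActsByIsometries m G M) {o : M} (hirr : IsotropyIrreducible m G o)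
    (hφ : ContMDiff (𝓡 m) 𝓘(ℝ, E) ∞ φ) (hR : ∀ g p, φ (g • p) = R g (φ p)) :
    ∃ κ : ℝ, 0 ≤ κ ∧ ∀ (p : M) (v : TangentSpace (𝓡 m) p),
      ‖mvfderiv (𝓡 m) φ p v‖ = κ * ‖v‖ := by
  -- All tangent spaces share one underlying vector space, but the norm depends on the base point.
  -- It has to be transported along `g • o = o`.
  have hnorm : ∀ q, q = o → ∀ w : EuclideanSpace ℝ (Fin m),
      @norm (TangentSpace (𝓡 m) q) _ w = @norm (TangentSpace (𝓡 m) o) _ w := by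
    rintro _ rfl w
    rfl
  have hderiv : ∀ q, q = o → ∀ w : EuclideanSpace ℝ (Fin m),
      mvfderiv (𝓡 m) φ q w = mvfderiv (𝓡 m) φ o w := by
    rintro _ rfl w
    rfl
  obtain ⟨κ, hκ, h⟩ := exists_norm_eq_mul_norm_of_irreducible
    (E := TangentSpace (𝓡 m) o) (F := E) (mvfderiv (𝓡 m) φ o : TangentSpace (𝓡 m) o →ₗ[ℝ] E)
    {L | ∃ g : G, g • o = o ∧ ∀ v, L v = mfderiv (𝓡 m) (𝓡 m) (fun x : M => g • x) o v}
    (by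
      rintro L ⟨g, hgo, hL⟩ v
      rw [hL]
      exact (hnorm _ hgo _).symm.trans (hiso g o v))
    (by
      rintro L ⟨g, hgo, hL⟩ v
      rw [hL]
      have h := congrArg norm (mvfderiv_equivariant hg hφ hR g o v)
      rw [LinearIsometry.norm_map] at h
      exact (congrArg norm (hderiv _ hgo _).symm).trans h)
    (by
      intro W hW
      refine hirr W fun g hgo v hv => ?_
      let A : EuclideanSpace ℝ (Fin m) →L[ℝ] EuclideanSpace ℝ (Fin m) :=
        mfderiv (𝓡 m) (𝓡 m) (fun x : M => g • x) o
      exact hW A.toLinearMap ⟨g, hgo, fun v => rfl⟩ v hv)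
  refine ⟨κ, hκ, fun p v => ?_⟩
  obtain ⟨g, rfl⟩ := MulAction.exists_smul_eq G o p
  obtain ⟨w, rfl⟩ := hiso.surjective g o v
  rw [mvfderiv_equivariant hg hφ hR, LinearIsometry.norm_map, hiso]
  exact h w

end Homothety

/-! ### Attaining the maximal derivative -/

section Maximum

/-- A linear functional attains its maximum on the images of a sphere under a compact set of
isometries. -/
lemma exists_forall_inner_isometry_le {G : Type*} [TopologicalSpace G] [CompactSpace G]
    [Nonempty G] {T E : Type*} [NormedAddCommGroup T] [InnerProductSpace ℝ T]
    [FiniteDimensional ℝ T] [Nontrivial T] [NormedAddCommGroup E] [InnerProductSpace ℝ E]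
    [FiniteDimensional ℝ E] (R : G → E →ₗᵢ[ℝ] E)
    (hR : ∀ x y : E, Continuous fun g => ⟪x, R g y⟫_ℝ) (L : T →ₗ[ℝ] E) (u : E) :
    ∃ g w, ‖w‖ = 1 ∧ ∀ g' w', |⟪u, R g' (L w')⟫_ℝ| ≤ ⟪u, R g (L w)⟫_ℝ * ‖w'‖ := by
  have hcont : Continuous fun x : G × T => ⟪u, R x.1 (L x.2)⟫_ℝ := by
    -- The representation is only assumed weakly continuous. A finite basis expansion turns this
    -- into joint continuity in `(g, w)`.
    let b := stdOrthonormalBasis ℝ E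
    have h1 : ∀ x : G × T, ⟪u, R x.1 (L x.2)⟫_ℝ =
        ∑ j, ⟪b j, L x.2⟫_ℝ * ⟪u, R x.1 (b j)⟫_ℝ := fun x => by
      conv_lhs => rw [← b.sum_repr' (L x.2)]
      simp only [map_sum, map_smul, inner_sum, real_inner_smul_right]
    simp only [h1]
    refine continuous_finsetSum _ fun j _ => Continuous.mul ?_ ((hR u (b j)).comp continuous_fst)
    exact continuous_const.inner (L.continuous_of_finiteDimensional.comp continuous_snd)
  have : ProperSpace T := FiniteDimensional.proper_real T
  have hne : (univ ×ˢ Metric.sphere (0 : T) 1 : Set (G × T)).Nonempty :=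
    univ_nonempty.prod (NormedSpace.sphere_nonempty.2 zero_le_one)
  obtain ⟨⟨g, w⟩, ⟨-, hw⟩, hmax⟩ := (isCompact_univ.prod (isCompact_sphere (0 : T) 1)).exists_isMaxOn
    hne hcont.continuousOn
  have hpos : ∀ g' w', ⟪u, R g' (L w')⟫_ℝ ≤ ⟪u, R g (L w)⟫_ℝ * ‖w'‖ := by
    intro g' w'
    rcases eq_or_ne w' 0 with rfl | hw'
    · simp
    · have hn : 0 < ‖w'‖ := norm_pos_iff.2 hw'
      have h2 := hmax (a := (g', ‖w'‖⁻¹ • w')) ⟨mem_univ _, by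
        simp [norm_smul, hn.ne']⟩
      simp only [map_smul, real_inner_smul_right, mem_ofPred_eq] at h2
      rwa [inv_mul_le_iff₀ hn, mul_comm] at h2
  refine ⟨g, w, by simpa using hw, fun g' w' => abs_le.2 ⟨?_, hpos g' w'⟩⟩
  have := hpos g' (-w')
  rw [map_neg, map_neg, inner_neg_right, norm_neg] at this
  linarith

end Maximum

/-! ### Least Lipschitz constants and equality in Cauchy-Schwarz -/

section Lipschitz

lemma mvfderiv_inner_const {m : ℕ} {M : Type*} [TopologicalSpace M]
    [ChartedSpace (EuclideanSpace ℝ (Fin m)) M] {E : Type*} [NormedAddCommGroup E]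
    [InnerProductSpace ℝ E] {φ : M → E} {p : M} (hφ : MDifferentiableAt (𝓡 m) 𝓘(ℝ, E) φ p)
    (u : E) (v : TangentSpace (𝓡 m) p) :
    mvfderiv (𝓡 m) (fun q => ⟪u, φ q⟫_ℝ) p v = ⟪u, mvfderiv (𝓡 m) φ p v⟫_ℝ := by
  have h : HasMFDerivAt 𝓘(ℝ, E) 𝓘(ℝ, ℝ) (innerSL ℝ u) (φ p) (innerSL ℝ u) :=
    (innerSL ℝ u).hasFDerivAt.hasMFDerivAt
  have h2 : mfderiv (𝓡 m) 𝓘(ℝ, ℝ) (fun q => ⟪u, φ q⟫_ℝ) p =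
      (innerSL ℝ u).comp (mfderiv (𝓡 m) 𝓘(ℝ, E) φ p : EuclideanSpace ℝ (Fin m) →L[ℝ] E) :=
    (h.comp p hφ.hasMFDerivAt).mfderiv
  have h3 := congrArg (fun A : EuclideanSpace ℝ (Fin m) →L[ℝ] ℝ => A v) h2
  exact h3

/-- Equality in the Cauchy-Schwarz inequality. -/
lemma eq_inv_smul_of_le_inner {E : Type*} [NormedAddCommGroup E] [InnerProductSpace ℝ E]
    {u x : E} {κ : ℝ} (hκ : 0 < κ) (hu : ‖u‖ = 1) (hx : ‖x‖ = κ) (h : κ ≤ ⟪u, x⟫_ℝ) :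
    u = κ⁻¹ • x := by
  have h1 : ‖x - κ • u‖ ^ 2 ≤ 0 := by
    rw [norm_sub_sq_real, norm_smul, hx, hu, real_inner_smul_right, real_inner_comm,
      Real.norm_eq_abs, mul_one, sq_abs]
    nlinarith
  have h2 : x - κ • u = 0 := norm_eq_zero.1 (pow_eq_zero_iff two_ne_zero |>.1
    (le_antisymm h1 (sq_nonneg _)))
  rw [sub_eq_zero.1 h2, smul_smul, inv_mul_cancel₀ hκ.ne', one_smul]

variable {m : ℕ} {M : Type*} [MetricSpace M] [ChartedSpace (EuclideanSpace ℝ (Fin m)) M]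
  [RiemannianBundle (fun x : M => TangentSpace (𝓡 m) x)] [IsRiemannianManifold (𝓡 m) M]
  {E : Type*} [NormedAddCommGroup E] [InnerProductSpace ℝ E]
  {φ : M → E} {κ : ℝ}

lemma abs_inner_sub_inner_le (hφ : ContMDiff (𝓡 m) 𝓘(ℝ, E) ∞ φ) {u : E} {K : ℝ} (hK : 0 ≤ K)
    (h : ∀ (p : M) (v : TangentSpace (𝓡 m) p), |⟪u, mvfderiv (𝓡 m) φ p v⟫_ℝ| ≤ K * ‖v‖)
    (p q : M) : |⟪u, φ p⟫_ℝ - ⟪u, φ q⟫_ℝ| ≤ K * dist p q := by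
  have hφd : MDifferentiable (𝓡 m) 𝓘(ℝ, E) φ := hφ.mdifferentiable (by simp)
  have hs : ContMDiff (𝓡 m) 𝓘(ℝ, ℝ) ∞ fun q => ⟪u, φ q⟫_ℝ :=
    (innerSL ℝ u).contMDiff.comp hφ
  refine abs_sub_le_of_abs_mvfderiv_le (f := fun q => ⟪u, φ q⟫_ℝ) (hs.of_le (by simp)) hK
    (fun p v => ?_) p q
  rw [mvfderiv_inner_const (hφd p)]
  exact h p v

lemma abs_inner_sub_inner_le_of_norm_eq_one (hφ : ContMDiff (𝓡 m) 𝓘(ℝ, E) ∞ φ) (hκ : 0 ≤ κ)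
    (hnorm : ∀ (p : M) (v : TangentSpace (𝓡 m) p), ‖mvfderiv (𝓡 m) φ p v‖ = κ * ‖v‖)
    {u : E} (hu : ‖u‖ = 1) (p q : M) : |⟪u, φ p⟫_ℝ - ⟪u, φ q⟫_ℝ| ≤ κ * dist p q := by
  refine abs_inner_sub_inner_le hφ hκ (fun p v => ?_) p q
  refine (abs_real_inner_le_norm _ _).trans ?_
  rw [hu, one_mul, hnorm]

/-- If `φ` is a homothety of ratio `κ` and `u = κ⁻¹ dφ(v)` for a unit tangent vector `v`, then `κ`
is the least Lipschitz constant of `⟨u, φ⟩`. -/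
lemma isLeast_lipschitz_of_eq_mvfderiv [IsManifold (𝓡 m) ∞ M]
    [IsContMDiffRiemannianBundle (𝓡 m) ∞ (EuclideanSpace ℝ (Fin m))
      (fun x : M => TangentSpace (𝓡 m) x)] (hφ : ContMDiff (𝓡 m) 𝓘(ℝ, E) ∞ φ) (hκ : 0 < κ)
    (hnorm : ∀ (p : M) (v : TangentSpace (𝓡 m) p), ‖mvfderiv (𝓡 m) φ p v‖ = κ * ‖v‖)
    {u : E} (hu : ‖u‖ = 1) {p : M} {v : TangentSpace (𝓡 m) p} (hv : ‖v‖ = 1)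
    (huv : u = κ⁻¹ • mvfderiv (𝓡 m) φ p v) :
    IsLeast {K : ℝ | 0 ≤ K ∧ ∀ p q : M, |⟪u, φ p⟫_ℝ - ⟪u, φ q⟫_ℝ| ≤ K * dist p q} κ := by
  have hφd : MDifferentiable (𝓡 m) 𝓘(ℝ, E) φ := hφ.mdifferentiable (by simp)
  refine ⟨⟨hκ.le, abs_inner_sub_inner_le_of_norm_eq_one hφ hκ.le hnorm hu⟩, fun K hK => ?_⟩
  have hs : ContMDiff (𝓡 m) 𝓘(ℝ, ℝ) ∞ fun q => ⟪u, φ q⟫_ℝ :=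
    (innerSL ℝ u).contMDiff.comp hφ
  have h := abs_mvfderiv_le_of_lipschitz (f := fun q => ⟪u, φ q⟫_ℝ) hK.1 hK.2 p
    (hs.mdifferentiableAt (by simp)) v
  rw [mvfderiv_inner_const (hφd p), hv, mul_one] at h
  have h2 : ⟪u, mvfderiv (𝓡 m) φ p v⟫_ℝ = κ := by
    conv_lhs => rw [huv]
    rw [real_inner_smul_left, real_inner_self_eq_norm_sq, hnorm, hv]
    field_simp
  rw [h2] at h
  exact (le_abs_self κ).trans h

/-- If `φ` is an equivariant homothety of ratio `κ` and `κ` is the least Lipschitz constant of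
`⟨u, φ⟩`, then `u = κ⁻¹ dφ(v)` for a unit tangent vector `v`. -/
lemma exists_eq_mvfderiv_of_isLeast_lipschitz {G : Type*} [Group G] [TopologicalSpace G]
    [CompactSpace G] [MulAction G M] [MulAction.IsPretransitive G M] [FiniteDimensional ℝ E]
    (hg : ∀ g : G, ContMDiff (𝓡 m) (𝓡 m) ∞ fun x : M => g • x)
    (hiso : ActsByIsometries m G M) (o : M)
    (hφ : ContMDiff (𝓡 m) 𝓘(ℝ, E) ∞ φ) {R : G → E →ₗᵢ[ℝ] E}
    (hRc : ∀ x y : E, Continuous fun g => ⟪x, R g y⟫_ℝ) (hR : ∀ g p, φ (g • p) = R g (φ p))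
    (hκ : 0 < κ) (hT : ∃ (p : M) (v : TangentSpace (𝓡 m) p), v ≠ 0)
    (hnorm : ∀ (p : M) (v : TangentSpace (𝓡 m) p), ‖mvfderiv (𝓡 m) φ p v‖ = κ * ‖v‖)
    {u : E} (hu : ‖u‖ = 1)
    (hleast : IsLeast {K : ℝ | 0 ≤ K ∧ ∀ p q : M, |⟪u, φ p⟫_ℝ - ⟪u, φ q⟫_ℝ| ≤ K * dist p q} κ) :
    ∃ (p : M) (v : TangentSpace (𝓡 m) p), ‖v‖ = 1 ∧ u = κ⁻¹ • mvfderiv (𝓡 m) φ p v := by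
  have : Nontrivial (TangentSpace (𝓡 m) o) := by
    obtain ⟨p, v, hv⟩ := hT
    obtain ⟨g, rfl⟩ := MulAction.exists_smul_eq G o p
    obtain ⟨w, rfl⟩ := hiso.surjective g o v
    exact ⟨w, 0, fun h => hv (by rw [h, map_zero])⟩
  obtain ⟨g, w, hw, hmax⟩ := exists_forall_inner_isometry_le R hRc
    (T := TangentSpace (𝓡 m) o) (mvfderiv (𝓡 m) φ o : TangentSpace (𝓡 m) o →ₗ[ℝ] E) u
  have hmax' : ∀ (p : M) (v : TangentSpace (𝓡 m) p), |⟪u, mvfderiv (𝓡 m) φ p v⟫_ℝ| ≤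
      ⟪u, R g (mvfderiv (𝓡 m) φ o w)⟫_ℝ * ‖v‖ := by
    intro p v
    obtain ⟨g', rfl⟩ := MulAction.exists_smul_eq G o p
    obtain ⟨w', rfl⟩ := hiso.surjective g' o v
    rw [mvfderiv_equivariant hg hφ hR, hiso]
    exact hmax g' w'
  have hK : 0 ≤ ⟪u, R g (mvfderiv (𝓡 m) φ o w)⟫_ℝ := by
    have := (abs_nonneg _).trans (hmax' o w)
    rwa [hw, mul_one] at this
  -- The maximal derivative is itself a Lipschitz constant, so it is at least `κ`. Since `u` is a
  -- unit vector and the maximizing `R g (dφ w)` has norm `κ`, equality holds in Cauchy-Schwarz.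
  have hle := hleast.2 ⟨hK, abs_inner_sub_inner_le hφ hK hmax'⟩
  refine ⟨g • o, mfderiv (𝓡 m) (𝓡 m) (fun x : M => g • x) o w, by rw [hiso, hw], ?_⟩
  rw [mvfderiv_equivariant hg hφ hR]
  refine eq_inv_smul_of_le_inner hκ hu ?_ hle
  rw [LinearIsometry.norm_map, hnorm, hw, mul_one]

end Lipschitz

/-! ### Orbit maps and stabilizer algebras -/

section Orbit

/-- The composition of a linear isometry with a map that is isometric on the orthogonal complement
of its kernel is isometric on the orthogonal complement of its kernel. -/
lemma norm_comp_isometry_of_orthogonal_ker {E₁ E₂ F : Type*} [NormedAddCommGroup E₁]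
    [InnerProductSpace ℝ E₁] [NormedAddCommGroup E₂] [InnerProductSpace ℝ E₂]
    [NormedAddCommGroup F] [NormedSpace ℝ F] (R : E₁ →ₗ[ℝ] E₂) (hR : ∀ v, ‖R v‖ = ‖v‖)
    (hRs : Function.Surjective R) (A : E₂ →ₗ[ℝ] F)
    (hA : ∀ v, (∀ w, A w = 0 → ⟪v, w⟫_ℝ = 0) → ‖A v‖ = ‖v‖) (v : E₁)
    (hv : ∀ w, A (R w) = 0 → ⟪v, w⟫_ℝ = 0) : ‖A (R v)‖ = ‖v‖ := by
  rw [hA (R v) fun w hw => ?_, hR]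
  obtain ⟨w, rfl⟩ := hRs w
  exact ((⟨R, hR⟩ : E₁ →ₗᵢ[ℝ] E₂).inner_map_map v w).trans (hv w hw)

/-- The orbit maps of a smooth action are smooth. -/
lemma contMDiff_orbitMap {n m : ℕ} {G : Type*} [Group G] [TopologicalSpace G]
    [ChartedSpace (EuclideanSpace ℝ (Fin n)) G] {M : Type*} [TopologicalSpace M]
    [ChartedSpace (EuclideanSpace ℝ (Fin m)) M] [MulAction G M]
    [ContMDiffSMul (𝓡 n) (𝓡 m) ∞ G M] (p : M) :
    ContMDiff (𝓡 n) (𝓡 m) ∞ fun g : G => g • p :=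
  (contMDiff_smul (I := 𝓡 n) (I' := 𝓡 m)).comp (contMDiff_id.prodMk contMDiff_const)

lemma IsBiInvariant.surjective_mul_right {n : ℕ} {G : Type*} [Group G]
    [TopologicalSpace G] [ChartedSpace (EuclideanSpace ℝ (Fin n)) G]
    [RiemannianBundle (fun g : G => TangentSpace (𝓡 n) g)]
    (hbi : IsBiInvariant n G) (a g : G) :
    Function.Surjective (mfderiv (𝓡 n) (𝓡 n) (fun h : G => h * a) g) := by
  have hinj : Function.Injective (mfderiv (𝓡 n) (𝓡 n) (fun h : G => h * a) g) := by
    refine (injective_iff_map_eq_zero _).2 fun v hv => ?_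
    rw [← norm_eq_zero, ← (hbi a g v).2, hv, norm_zero]
  let A : EuclideanSpace ℝ (Fin n) →L[ℝ] EuclideanSpace ℝ (Fin n) :=
    mfderiv (𝓡 n) (𝓡 n) (fun h : G => h * a) g
  exact (LinearMap.injective_iff_surjective (f := A.toLinearMap)).1 hinj

variable {n m : ℕ} {G : Type*} [Group G] [TopologicalSpace G]
  [ChartedSpace (EuclideanSpace ℝ (Fin n)) G] [LieGroup (𝓡 n) ∞ G]
  {M : Type*} [TopologicalSpace M] [ChartedSpace (EuclideanSpace ℝ (Fin m)) M]
  [MulAction G M]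

/-- If one orbit map is a metric submersion for a bi-invariant metric, then all orbit maps are. -/
lemma orbit_submersion [RiemannianBundle (fun g : G => TangentSpace (𝓡 n) g)]
    [RiemannianBundle (fun x : M => TangentSpace (𝓡 m) x)] [MulAction.IsPretransitive G M]
    (hbi : IsBiInvariant n G) {o : M}
    (hsub : IsMetricSubmersion (n := n) (m := m) (fun g : G => g • o)) (p : M) :
    Function.Surjective (mfderiv (𝓡 n) (𝓡 m) (fun g : G => g • p) 1) ∧
    ∀ ξ : TangentSpace (𝓡 n) (1 : G),
      (∀ w : TangentSpace (𝓡 n) (1 : G),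
        mfderiv (𝓡 n) (𝓡 m) (fun g : G => g • p) 1 w = 0 → inner ℝ ξ w = 0) →
      ‖mfderiv (𝓡 n) (𝓡 m) (fun g : G => g • p) 1 ξ‖ = ‖ξ‖ := by
  obtain ⟨a, rfl⟩ := MulAction.exists_smul_eq G o p
  -- The orbit map of `a • o` is that of `o` preceded by a right translation, which is an isometry
  -- of `G`.
  have hcomp : (fun g : G => g • a • o) = (fun g : G => g • o) ∘ fun g : G => g * a :=
    funext fun g => (mul_smul g a o).symm
  have hda : MDifferentiableAt (𝓡 n) (𝓡 n) (fun g : G => g * a) 1 :=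
    (contMDiff_mul_right (I := 𝓡 n) (n := ∞) (a := a)).mdifferentiableAt (by simp)
  have hdo : MDifferentiableAt (𝓡 n) (𝓡 m) (fun g : G => g • o) (1 * a) :=
    hsub.1.mdifferentiableAt (by simp)
  have hd := mfderiv_comp (1 : G) hdo hda
  have hs := hbi.surjective_mul_right a 1
  -- The map `f` is a variable here because the tangent space at `f 1` depends on it, and
  -- substituting `f` moves the type along.
  have key : ∀ f : G → M, f = (fun g : G => g • o) ∘ (fun g : G => g * a) →
      Function.Surjective (mfderiv (𝓡 n) (𝓡 m) f 1) ∧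
      ∀ ξ : TangentSpace (𝓡 n) (1 : G),
        (∀ w : TangentSpace (𝓡 n) (1 : G), mfderiv (𝓡 n) (𝓡 m) f 1 w = 0 → inner ℝ ξ w = 0) →
        ‖mfderiv (𝓡 n) (𝓡 m) f 1 ξ‖ = ‖ξ‖ := by
    rintro _ rfl
    rw [hd]
    refine ⟨(hsub.2 (1 * a)).1.comp hs, fun ξ hξ => ?_⟩
    exact norm_comp_isometry_of_orthogonal_ker
      (mfderiv (𝓡 n) (𝓡 n) (fun g : G => g * a) 1).toLinearMap (fun v => (hbi a 1 v).2) hs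
      (mfderiv (𝓡 n) (𝓡 m) (fun g : G => g • o) (1 * a)).toLinearMap (hsub.2 (1 * a)).2 ξ hξ
  exact key _ hcomp

variable [IsManifold (𝓡 m) ∞ M]

/-- Smooth local sections of the orbit maps. -/
lemma exists_orbit_section [ContMDiffSMul (𝓡 n) (𝓡 m) ∞ G M] (p : M)
    (hsurj : Function.Surjective (mfderiv (𝓡 n) (𝓡 m) (fun g : G => g • p) 1)) :
    ∃ σ : M → G, σ p = 1 ∧ ContMDiffAt (𝓡 m) (𝓡 n) ∞ σ p ∧ ∀ᶠ q in 𝓝 p, σ q • p = q := by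
  have horb : ContMDiff (𝓡 n) (𝓡 m) ∞ fun g : G => g • p := contMDiff_orbitMap p
  obtain ⟨σ, h1, h2, h3⟩ := exists_local_section horb.contMDiffAt hsurj
  rw [one_smul] at h1 h2 h3
  exact ⟨σ, h1, h2, h3⟩

/-- The velocity of the product of two curves in a Lie group, if the first one passes through the
identity with velocity zero. -/
lemma mfderiv_mul_of_mfderiv_eq_zero {α c : ℝ → G} (hα0 : α 0 = 1)
    (hα : MDifferentiableAt 𝓘(ℝ, ℝ) (𝓡 n) α 0) (hc : MDifferentiableAt 𝓘(ℝ, ℝ) (𝓡 n) c 0)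
    (hα' : mfderiv 𝓘(ℝ, ℝ) (𝓡 n) α 0 (1 : ℝ) = 0) :
    (mfderiv 𝓘(ℝ, ℝ) (𝓡 n) (fun t => α t * c t) 0 (1 : ℝ) : EuclideanSpace ℝ (Fin n)) =
      mfderiv 𝓘(ℝ, ℝ) (𝓡 n) c 0 (1 : ℝ) := by
  have hmul : MDifferentiableAt ((𝓡 n).prod (𝓡 n)) (𝓡 n) (fun p : G × G => p.1 * p.2)
      (α 0, c 0) := (contMDiff_mul (𝓡 n) ∞).mdifferentiableAt (by simp)
  have h1 := mfderiv_comp (0 : ℝ) hmul (hα.prodMk hc)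
  have h2 : (fun z : G => α 0 * z) = id := funext fun z => by rw [hα0, one_mul, id]
  have h3 := mfderiv_prod_eq_add_apply hmul
    (v := mfderiv 𝓘(ℝ, ℝ) ((𝓡 n).prod (𝓡 n)) (fun t => (α t, c t)) 0 (1 : ℝ))
  have h4 : ∀ w : EuclideanSpace ℝ (Fin n),
      (mfderiv (𝓡 n) (𝓡 n) (fun z : G => α 0 * z) (c 0) w : EuclideanSpace ℝ (Fin n)) = w := by
    intro w
    rw [h2, mfderiv_id]
    rfl
  have h5 : (mfderiv (𝓡 n) (𝓡 n) (fun z : G => z * c 0) (α 0)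
      (mfderiv 𝓘(ℝ, ℝ) (𝓡 n) α 0 (1 : ℝ)) : EuclideanSpace ℝ (Fin n)) = 0 := by
    rw [hα']
    exact map_zero (mfderiv (𝓡 n) (𝓡 n) (fun z : G => z * c 0) (α 0))
  refine (DFunLike.congr_fun h1 (1 : ℝ)).trans (h3.trans ?_)
  rw [mfderiv_prodMk hα hc]
  exact (congrArg₂ (fun x y : EuclideanSpace ℝ (Fin n) => x + y) h5 (h4 _)).trans (zero_add _)

/-- The Lie algebra of the stabilizer of `p` is the kernel of the differential of the orbit map. -/
lemma mem_stabilizerAlgebra_iff [ContMDiffSMul (𝓡 n) (𝓡 m) ∞ G M] (p : M)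
    (hsurj : Function.Surjective (mfderiv (𝓡 n) (𝓡 m) (fun g : G => g • p) 1))
    (ξ : TangentSpace (𝓡 n) (1 : G)) :
    ξ ∈ stabilizerAlgebra n G p ↔ mfderiv (𝓡 n) (𝓡 m) (fun g : G => g • p) 1 ξ = 0 := by
  have horb : ContMDiff (𝓡 n) (𝓡 m) ∞ fun g : G => g • p := contMDiff_orbitMap p
  have horbd : MDifferentiable (𝓡 n) (𝓡 m) fun g : G => g • p := horb.mdifferentiable (by simp)
  have htrans : ∀ g : G, g = 1 → ∀ w : EuclideanSpace ℝ (Fin n),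
      (mfderiv (𝓡 n) (𝓡 m) (fun g : G => g • p) g w : EuclideanSpace ℝ (Fin m)) =
        mfderiv (𝓡 n) (𝓡 m) (fun g : G => g • p) 1 w := by
    rintro _ rfl w
    rfl
  constructor
  · rintro ⟨γ, hγ0, hγs, hγd, rfl⟩
    refine (htrans _ hγ0 _).symm.trans ?_
    have h1 := mfderiv_comp (0 : ℝ) (horbd (γ 0)) hγd
    have h2 : (fun g : G => g • p) ∘ γ = fun _ => p := funext fun t => hγs t
    have h3 : mfderiv 𝓘(ℝ, ℝ) (𝓡 m) ((fun g : G => g • p) ∘ γ) 0 (1 : ℝ) = 0 := by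
      rw [h2, mfderiv_const]
      rfl
    rw [h1] at h3
    exact h3
  · intro hξ
    obtain ⟨c, hc0, hc, hcξ⟩ := exists_curve_mfderiv_eq (1 : G) ξ
    -- The curve `c` with velocity `ξ` is pushed into the stabilizer by the factor `σ(c(t) p)⁻¹`.
    -- That factor has velocity zero at `0`, since `c(t) p` does, so the product still has velocity
    -- `ξ`.
    obtain ⟨σ, hσp, hσ, hσq⟩ := exists_orbit_section p hsurj
    have hcd : MDifferentiableAt 𝓘(ℝ, ℝ) (𝓡 n) c 0 := hc.mdifferentiableAt (by simp)
    have hcp : c 0 • p = p := by rw [hc0, one_smul]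
    have hcpd : MDifferentiableAt 𝓘(ℝ, ℝ) (𝓡 m) ((fun g : G => g • p) ∘ c) 0 :=
      (horbd (c 0)).comp 0 hcd
    have hcp' : mfderiv 𝓘(ℝ, ℝ) (𝓡 m) ((fun g : G => g • p) ∘ c) 0 (1 : ℝ) = 0 := by
      rw [mfderiv_comp (0 : ℝ) (horbd (c 0)) hcd]
      refine (htrans _ hc0 _).trans (Eq.trans ?_ hξ)
      exact congrArg _ hcξ
    have hτ : MDifferentiableAt (𝓡 m) (𝓡 n) (fun q => (σ q)⁻¹) (c 0 • p) := by
      rw [hcp]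
      exact hσ.inv.mdifferentiableAt (by simp)
    have hα : MDifferentiableAt 𝓘(ℝ, ℝ) (𝓡 n)
        ((fun q => (σ q)⁻¹) ∘ ((fun g : G => g • p) ∘ c)) 0 := hτ.comp 0 hcpd
    have hα' : mfderiv 𝓘(ℝ, ℝ) (𝓡 n)
        ((fun q => (σ q)⁻¹) ∘ ((fun g : G => g • p) ∘ c)) 0 (1 : ℝ) = 0 := by
      rw [mfderiv_comp (0 : ℝ) hτ hcpd]
      refine Eq.trans (congrArg (mfderiv (𝓡 m) (𝓡 n) (fun q => (σ q)⁻¹) (c 0 • p)) hcp') ?_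
      exact map_zero _
    have hα0 : ((fun q => (σ q)⁻¹) ∘ ((fun g : G => g • p) ∘ c)) 0 = 1 := by
      simp [hcp, hσp]
    have hprod := mfderiv_mul_of_mfderiv_eq_zero hα0 hα hcd hα'
    classical
    -- The section property holds only near `p`. The default value `1` keeps `γ t` in the stabilizer
    -- for all `t`.
    let γ : ℝ → G := fun t => if σ (c t • p) • p = c t • p then (σ (c t • p))⁻¹ * c t else 1
    have hcont : ContinuousAt (fun t => c t • p) 0 := hcpd.continuousAt
    have hev : γ =ᶠ[𝓝 0]
        fun t => ((fun q => (σ q)⁻¹) ∘ ((fun g : G => g • p) ∘ c)) t * c t := by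
      have : ∀ᶠ t in 𝓝 (0 : ℝ), σ (c t • p) • p = c t • p :=
        hcont.eventually (show ∀ᶠ q in 𝓝 (c 0 • p), σ q • p = q by rw [hcp]; exact hσq)
      filter_upwards [this] with t ht
      simp only [γ, if_pos ht, Function.comp]
    refine ⟨γ, ?_, fun t => ?_, ?_, ?_⟩
    · simp [γ, hσp, hc0]
    · by_cases ht : σ (c t • p) • p = c t • p
      · simp only [γ, if_pos ht, MulAction.mem_stabilizer_iff, mul_smul]
        exact inv_smul_eq_iff.2 ht.symm
      · simp only [γ, if_neg ht]
        exact one_mem _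
    · refine MDifferentiableAt.congr_of_eventuallyEq ?_ hev
      exact ((contMDiff_mul (𝓡 n) ∞).mdifferentiableAt (by simp)).comp (0 : ℝ) (hα.prodMk hcd)
    · refine (DFunLike.congr_fun hev.mfderiv_eq (1 : ℝ)).trans ?_
      exact hprod.trans hcξ

end Orbit

/-! ### Derivatives along induced vector fields -/

section ActionDeriv

/-- Derivatives of functions along a tangent vector are derivatives along a curve. -/
lemma exists_curve_hasDerivAt {m : ℕ} {M : Type*} [TopologicalSpace M]
    [ChartedSpace (EuclideanSpace ℝ (Fin m)) M] [IsManifold (𝓡 m) ∞ M] {F : Type*}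
    [NormedAddCommGroup F] [NormedSpace ℝ F] (p : M) (v : TangentSpace (𝓡 m) p) :
    ∃ γ : ℝ → M, γ 0 = p ∧ ∀ f : M → F, MDifferentiableAt (𝓡 m) 𝓘(ℝ, F) f p →
      HasDerivAt (f ∘ γ) (mvfderiv (𝓡 m) f p v) 0 := by
  obtain ⟨γ, rfl, hγ, rfl⟩ := exists_curve_mfderiv_eq p v
  exact ⟨γ, rfl, fun f hf => mvfderiv_comp_curve hf (hγ.mdifferentiableAt (by simp))⟩

variable {n m : ℕ} {G : Type*} [Group G] [TopologicalSpace G]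
  [ChartedSpace (EuclideanSpace ℝ (Fin n)) G]
  {M : Type*} [TopologicalSpace M] [ChartedSpace (EuclideanSpace ℝ (Fin m)) M]
  [MulAction G M] [ContMDiffSMul (𝓡 n) (𝓡 m) ∞ G M]
  {E : Type*} [NormedAddCommGroup E] [InnerProductSpace ℝ E]
  {φ : M → E} {R : G → E →ₗᵢ[ℝ] E}

lemma mvfderiv_comp_orbit (hφ : ContMDiff (𝓡 m) 𝓘(ℝ, E) ∞ φ) (p : M)
    (ξ : TangentSpace (𝓡 n) (1 : G)) :
    mvfderiv (𝓡 n) (fun g : G => φ (g • p)) 1 ξ =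
      mvfderiv (𝓡 m) φ p (mfderiv (𝓡 n) (𝓡 m) (fun g : G => g • p) 1 ξ) := by
  have htrans : ∀ q, q = p → ∀ w : EuclideanSpace ℝ (Fin m),
      mvfderiv (𝓡 m) φ q w = mvfderiv (𝓡 m) φ p w := by
    rintro _ rfl w
    rfl
  have h := mfderiv_comp (1 : G) (hφ.mdifferentiable (by simp) ((1 : G) • p))
    ((contMDiff_orbitMap (G := G) (n := n) (m := m) p).mdifferentiableAt (by simp))
  exact (DFunLike.congr_fun h ξ).trans (htrans _ (one_smul G p) _)

variable [LieGroup (𝓡 n) ∞ G]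

/-- The derivative of `⟨φ_p, φ⟩` along the field induced by `ξ` is `-⟨dφ(ξ p), φ⟩`. -/
lemma actionDeriv_inner (hφ : ContMDiff (𝓡 m) 𝓘(ℝ, E) ∞ φ)
    (hR : ∀ g p, φ (g • p) = R g (φ p)) (ξ : TangentSpace (𝓡 n) (1 : G)) (p q : M) :
    actionDeriv ξ (fun x => ⟪φ p, φ x⟫_ℝ) q =
      -⟪mvfderiv (𝓡 m) φ p (mfderiv (𝓡 n) (𝓡 m) (fun g : G => g • p) 1 ξ), φ q⟫_ℝ := by
  have hd : ∀ x : M, MDifferentiableAt (𝓡 n) 𝓘(ℝ, E) (fun g : G => φ (g • x)) 1 := fun x =>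
    (hφ.comp (contMDiff_orbitMap (G := G) x)).mdifferentiableAt (by simp)
  obtain ⟨c, hc0, hc⟩ := exists_curve_hasDerivAt (F := E) (1 : G) ξ
  have h1 := (hc _ (hd p)).inner ℝ (hc _ (hd q))
  -- The inner product is invariant when both points move together, so the two terms of the product
  -- rule cancel.
  have h2 : (fun t => ⟪((fun g : G => φ (g • p)) ∘ c) t, ((fun g : G => φ (g • q)) ∘ c) t⟫_ℝ) =
      fun _ => ⟪φ p, φ q⟫_ℝ := by
    funext t
    simp only [Function.comp, hR, LinearIsometry.inner_map_map]
  rw [h2] at h1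
  have h3 := h1.unique (hasDerivAt_const _ _)
  simp only [Function.comp, hc0, one_smul] at h3
  rw [← mvfderiv_comp_orbit hφ]
  have h4 : actionDeriv ξ (fun x => ⟪φ p, φ x⟫_ℝ) q =
      ⟪φ p, mvfderiv (𝓡 n) (fun g : G => φ (g • q)) 1 ξ⟫_ℝ := mvfderiv_inner_const (hd q) _ ξ
  rw [h4]
  linarith

end ActionDeriv

/-! ### Conclusion -/

section Main

/-- If the coefficients `⟨u, φ_p⟩` of the elements of a subspace of `L²(M)` orthogonal to the
constants do not depend on `p`, then the subspace is trivial. -/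
lemma eq_bot_of_contRep_const {M : Type*} [TopologicalSpace M] [MeasurableSpace M] {μ : Measure M}
    [IsProbabilityMeasure μ] {V : Submodule ℝ (Lp ℝ 2 μ)}
    (hV1 : ∀ u ∈ V, ∫ x, u x ∂μ = 0) (hrep : ∀ u ∈ V, contRep u =ᵐ[μ] u)
    (hconst : ∀ u ∈ V, ∀ p q, contRep u p = contRep u q) : V = ⊥ := by
  refine (Submodule.eq_bot_iff V).2 fun u hu => ?_
  have hne : Nonempty M := μ.nonempty_of_neZero
  obtain ⟨p⟩ := hne
  have h1 : (u : M → ℝ) =ᵐ[μ] fun _ => contRep u p := by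
    filter_upwards [hrep u hu] with x hx
    rw [← hx, hconst u hu]
  have h2 := hV1 u hu
  rw [integral_congr_ae h1] at h2
  simp only [integral_const, probReal_univ, one_smul] at h2
  rw [h2] at h1
  exact Lp.eq_zero_iff_ae_eq_zero.2 h1

/-- The vectors `φ_p` span. -/
lemma eq_zero_of_inner_evalVec {M : Type*} [TopologicalSpace M] [MeasurableSpace M] {μ : Measure M}
    [μ.IsOpenPosMeasure] {V : Submodule ℝ (Lp ℝ 2 μ)} [FiniteDimensional ℝ V]
    (hrep : ∀ u ∈ V, Continuous (contRep u) ∧ contRep u =ᵐ[μ] u) {u : V}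
    (h : ∀ p, ⟪u, evalVec V p⟫_ℝ = 0) : u = 0 := by
  refine Subtype.ext (Lp.eq_zero_iff_ae_eq_zero.2 ?_)
  filter_upwards [(hrep u u.2).2] with p hp
  rw [← hp, ← inner_evalVec hrep p u, h, Pi.zero_apply]

end Main

end

theorem mainTheorem9 {n m : ℕ}
    -- the compact Lie group `G` with its Riemannian metric
    (G : Type*) [Group G] [TopologicalSpace G] [T2Space G] [CompactSpace G]
    [ChartedSpace (EuclideanSpace ℝ (Fin n)) G] [LieGroup (𝓡 n) ∞ G]
    [RiemannianBundle (fun g : G => TangentSpace (𝓡 n) g)]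
    [IsContMDiffRiemannianBundle (𝓡 n) ∞ (EuclideanSpace ℝ (Fin n))
      (fun g : G => TangentSpace (𝓡 n) g)]
    -- the compact connected Riemannian manifold `M` with its Riemannian distance
    (M : Type*) [MetricSpace M] [CompactSpace M] [ConnectedSpace M]
    [ChartedSpace (EuclideanSpace ℝ (Fin m)) M] [IsManifold (𝓡 m) ∞ M]
    [RiemannianBundle (fun x : M => TangentSpace (𝓡 m) x)]
    [IsContMDiffRiemannianBundle (𝓡 m) ∞ (EuclideanSpace ℝ (Fin m))
      (fun x : M => TangentSpace (𝓡 m) x)]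
    [IsRiemannianManifold (𝓡 m) M]
    -- the smooth transitive isometric virtually effective isotropy irreducible action
    [MulAction G M] [ContMDiffSMul (𝓡 n) (𝓡 m) ∞ G M] [MulAction.IsPretransitive G M]
    (hiso : ActsByIsometries m G M)
    (heff : Finite (MulAction.toPermHom G M).ker)
    (o : M) (hirr : IsotropyIrreducible m G o)
    -- the metric of `G` is bi-invariant and `G → M` is a metric submersion
    (hbi : IsBiInvariant n G)
    (hsub : IsMetricSubmersion (n := n) (m := m) (fun g : G => g • o))
    -- the invariant probability measure
    [MeasurableSpace M] [BorelSpace M] (μ : Measure M) [IsProbabilityMeasure μ]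
    [SMulInvariantMeasure G M μ]
    -- the finite dimensional `G`-invariant subspace of `L²(M)`, orthogonal to constants
    (V : Submodule ℝ (Lp ℝ 2 μ)) [FiniteDimensional ℝ V] (hV0 : V ≠ ⊥)
    (hVG : IsInvariantSubspace G V) (hV1 : ∀ u ∈ V, ∫ x, u x ∂μ = 0) :
    -- the notation makes sense: representatives, evaluation vectors, `c` and `s`
    (∀ u ∈ V, ContMDiff (𝓡 m) 𝓘(ℝ, ℝ) ∞ (contRep u) ∧ contRep u =ᵐ[μ] u) ∧
    (∀ (p : M) (u : V), inner ℝ u (evalVec V p) = contRep (u : Lp ℝ 2 μ) p) ∧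
    (∀ p : M, ‖evalVec V p‖ = √(Module.finrank ℝ V : ℝ)) ∧
    ∃ s : ℝ, 0 < s ∧
      (∀ (p : M) (v : TangentSpace (𝓡 m) p), ‖sphereMapDeriv V p v‖ = s * ‖v‖) ∧
      -- the result, for `κ = c s` with `c = |φ_o|`
      ∀ κ : ℝ, κ = ‖evalVec V o‖ * s → ∀ u ∈ V, ‖u‖ = 1 →
        (∀ p q : M, |contRep u p - contRep u q| ≤ κ * dist p q) ∧
        (IsLeast {K : ℝ | 0 ≤ K ∧ ∀ p q : M, |contRep u p - contRep u q| ≤ K * dist p q} κ ↔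
          ∃ (p : M) (ξ : TangentSpace (𝓡 n) (1 : G)),
            (∀ η ∈ stabilizerAlgebra n G p, inner ℝ ξ η = 0) ∧ ‖ξ‖ = 1 ∧
            ∀ q : M, contRep u q =
              κ⁻¹ * actionDeriv ξ (contRep (evalVec V p : Lp ℝ 2 μ)) q) := by
  have : ContinuousSMul G M := ContMDiffSMul.continuousSMul (I := 𝓡 n) (I' := 𝓡 m) ∞
  have : IsTopologicalGroup G := topologicalGroup_of_lieGroup (𝓡 n) ∞
  -- By transitivity and compactness, finitely many translates of a nonempty open set cover `M`, so
  -- an invariant nonzero measure charges it.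
  have : μ.IsOpenPosMeasure := ⟨fun U hU hne =>
    (measure_isOpen_pos_of_smulInvariant_of_ne_zero G (NeZero.ne μ) hU hne).ne'⟩
  have hg : ∀ g : G, ContMDiff (𝓡 m) (𝓡 m) ∞ fun x : M => g • x := fun g =>
    (contMDiff_smul (I := 𝓡 n) (I' := 𝓡 m)).comp (contMDiff_const.prodMk contMDiff_id)
  have horb := fun p : M => orbit_submersion hbi hsub p
  have hrep : ∀ u ∈ V, ContMDiff (𝓡 m) 𝓘(ℝ, ℝ) ∞ (contRep u) ∧ contRep u =ᵐ[μ] u := by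
    intro u hu
    obtain ⟨f, hf, hfu⟩ := exists_contMDiff_ae_eq
      (fun p : M => exists_orbit_section p (horb p).1) hVG hu
    rw [contRep_eq hf.continuous hfu]
    exact ⟨hf, hfu⟩
  have hrepc : ∀ u ∈ V, Continuous (contRep u) ∧ contRep u =ᵐ[μ] u := fun u hu =>
    ⟨(hrep u hu).1.continuous, (hrep u hu).2⟩
  have hφ := contMDiff_evalVec hrep
  have heval : ∀ u : V, contRep (u : Lp ℝ 2 μ) = fun p => inner ℝ u (evalVec V p) := fun u =>
    funext fun p => (inner_evalVec hrepc p u).symm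
  have hφn := norm_evalVec hVG hrepc
  have hR := evalVec_smul hVG hrepc
  have hRc : ∀ x y : V, Continuous fun g => inner ℝ x (translateRep hVG g y) := fun x y => by
    simp only [inner_translateRep_right]
    exact (contMDiff_inner_translateLp (n := n) m hVG x y).continuous
  obtain ⟨κ, hκ, hnorm⟩ := exists_norm_mvfderiv_eq hg hiso hirr hφ hR
  -- If `dφ` vanished, every element of `V` would be `0`-Lipschitz, hence constant, hence zero by
  -- orthogonality to the constants.
  have hne : ∃ (p : M) (v : TangentSpace (𝓡 m) p), mvfderiv (𝓡 m) (evalVec V) p v ≠ 0 := by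
    by_contra! h
    refine hV0 (eq_bot_of_contRep_const hV1 (fun u hu => (hrep u hu).2) fun u hu p q => ?_)
    have h1 := abs_inner_sub_inner_le hφ (u := (⟨u, hu⟩ : V)) le_rfl
      (fun p v => by rw [h p v, inner_zero_right, abs_zero, zero_mul]) p q
    rw [zero_mul, inner_evalVec hrepc, inner_evalVec hrepc] at h1
    exact sub_eq_zero.1 (abs_nonpos_iff.1 h1)
  have hT : ∃ (p : M) (v : TangentSpace (𝓡 m) p), v ≠ 0 := by
    obtain ⟨p, v, hv⟩ := hne
    exact ⟨p, v, fun h => hv (by rw [h, map_zero])⟩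
  have hκ0 : 0 < κ := by
    obtain ⟨p, v, hv⟩ := hne
    refine hκ.lt_of_ne fun h => hv ?_
    rw [← norm_eq_zero, hnorm, ← h, zero_mul]
  have hc : 0 < √(Module.finrank ℝ V : ℝ) := by
    have : Nontrivial V := Submodule.nontrivial_iff_ne_bot.2 hV0
    exact Real.sqrt_pos.2 (Nat.cast_pos.2 Module.finrank_pos)
  -- The homothety ratio of `ι = φ / c` is `s = κ / c`, so `c s` is the ratio `κ` of `φ`.
  refine ⟨hrep, inner_evalVec hrepc, hφn, (√(Module.finrank ℝ V : ℝ))⁻¹ * κ,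
    mul_pos (inv_pos.2 hc) hκ0, fun p v => ?_, ?_⟩
  · have h1 : sphereMap V = (√(Module.finrank ℝ V : ℝ))⁻¹ • evalVec V := funext fun q => by
      rw [sphereMap, hφn, Pi.smul_apply]
    have h2 : sphereMapDeriv V p v =
        (√(Module.finrank ℝ V : ℝ))⁻¹ • mvfderiv (𝓡 m) (evalVec V) p v := by
      rw [sphereMapDeriv, h1, const_smul_mfderiv (hφ.mdifferentiableAt (by simp))]
      rfl
    rw [h2, norm_smul, hnorm, Real.norm_of_nonneg (inv_nonneg.2 hc.le), mul_assoc]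
  intro κ' hκ'
  obtain rfl : κ' = κ := by
    rw [hκ', hφn, mul_inv_cancel_left₀ hc.ne']
  intro u hu hu1
  lift u to V using hu
  have hact : ∀ (p : M) (ξ : TangentSpace (𝓡 n) (1 : G)) (q : M),
      actionDeriv ξ (contRep (evalVec V p : Lp ℝ 2 μ)) q =
        inner ℝ (mvfderiv (𝓡 m) (evalVec V) p
          (-(mfderiv (𝓡 n) (𝓡 m) (fun g : G => g • p) 1 ξ))) (evalVec V q) := fun p ξ q => by
    rw [heval, actionDeriv_inner hφ hR, ← inner_neg_left]
    exact congrArg (fun x : V => inner ℝ x (evalVec V q))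
      (map_neg (mvfderiv (𝓡 m) (evalVec V) p) _).symm
  have hbase : ∀ (q q' : M), q = q' → ∀ w : EuclideanSpace ℝ (Fin m),
      @norm (TangentSpace (𝓡 m) q) _ w = @norm (TangentSpace (𝓡 m) q') _ w := by
    rintro q _ rfl w
    rfl
  simp only [heval u]
  refine ⟨abs_inner_sub_inner_le_of_norm_eq_one hφ hκ hnorm hu1, fun hleast => ?_, ?_⟩
  · obtain ⟨p, v, hv, huv⟩ :=
      exists_eq_mvfderiv_of_isLeast_lipschitz hg hiso o hφ hRc hR hκ0 hT hnorm hu1 hleast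
    -- The lift is taken of `-v`, which cancels the sign in `ξ φ_p = -dφ(ξ p)`.
    obtain ⟨ξ, hξ, hξv⟩ := exists_orthogonal_ker_map_eq
      (mfderiv (𝓡 n) (𝓡 m) (fun g : G => g • p) 1).toLinearMap (horb p).1
      (-(show TangentSpace (𝓡 m) ((1 : G) • p) from (v : EuclideanSpace ℝ (Fin m))))
    have hξv' : -(mfderiv (𝓡 n) (𝓡 m) (fun g : G => g • p) 1 ξ) = (v : EuclideanSpace ℝ (Fin m)) :=
      neg_eq_iff_eq_neg.2 hξv
    refine ⟨p, ξ, fun η hη => hξ η ((mem_stabilizerAlgebra_iff p (horb p).1 η).1 hη), ?_,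
      fun q => ?_⟩
    · rw [← (horb p).2 ξ hξ, ← norm_neg, ← hv]
      exact (hbase _ _ (one_smul G p) _).trans (congrArg norm hξv')
    · rw [hact, ← real_inner_smul_left]
      refine congrArg (fun x : V => inner ℝ x (evalVec V q)) (huv.trans ?_)
      exact congrArg (fun w => κ'⁻¹ • mvfderiv (𝓡 m) (evalVec V) p w) hξv'.symm
  · rintro ⟨p, ξ, hξ, hξ1, huξ⟩
    refine isLeast_lipschitz_of_eq_mvfderiv hφ hκ0 hnorm hu1 (p := p)
      (v := -(mfderiv (𝓡 n) (𝓡 m) (fun g : G => g • p) 1 ξ)) ?_ ?_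
    · refine (hbase _ _ (one_smul G p) _).symm.trans ?_
      refine (norm_neg (mfderiv (𝓡 n) (𝓡 m) (fun g : G => g • p) 1 ξ)).trans ?_
      rw [(horb p).2 ξ fun w hw => hξ w ((mem_stabilizerAlgebra_iff p (horb p).1 w).2 hw), hξ1]
    -- The hypothesis is an identity of functions. It becomes one of vectors in `V` because the
    -- `φ_q` span `V`.
    · refine sub_eq_zero.1 (eq_zero_of_inner_evalVec hrepc fun q => ?_)
      rw [inner_sub_left, real_inner_smul_left, ← hact, ← huξ, sub_self]
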